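/- Let $\mathcal H$ be a separable infinite-dimensional complex Hilbert space. For $1<p<\infty$ let $\Phi_p^-$ be the norming function $$\Phi_p^-(\xi)=\sum_{j\ge 1} j^{-1+1/p}\,\xi_j^*$$ on finitely supported real sequences $\xi$, where $\xi^*$ is the decreasing rearrangement of $(|\xi_j|)_j$. For a norming function $\Phi$ put $|T|_\Phi=\Phi(s(T))$ for a finite rank operator $T$ on $\mathcal H$, where $s(T)$ is the sequence of eigenvalues of $(T^*T)^{1/2}$ repeated according to multiplicity, and $|T|_\Phi=\sup_P|TP|_\Phi\in[0,\infty]$ for a bounded operator $T$, where $P$ runs over the finite rank orthogonal projections. For an $n$-tuple $\varphi=(\varphi(1),\dots,\varphi(n))$ of norming functions and an $n$-tuple $\tau=(\tau(1),\dots,\tau(n))$ of bounded operators on $\mathcal H$ let $$k_\varphi(\tau)=\liminf_{A}\ \max_{1\le j\le n}\bigl|\,\tau(j)A-A\tau(j)\,\bigr|_{\varphi(j)}\in[0,\infty],$$ the lower limit being along the set of finite rank operators $A$ with $0\le A\le I$, directed by the natural order, and let $\|\tau\|=\max_{1\le j\le n}\|\tau(j)\|$. **Proposition.** Let $p_1,\dots,p_n>1$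 with $\sum_{j=1}^n 1/p_j=1$ and let $\varphi(j)=\Phi_{p_j}^-$ for $1\le j\le n$. Let $\tau$ be an $n$-tuple of commuting hermitian bounded operators on $\mathcal H$. 1. If the spectral measure $E$ of $\tau$ (a projection-valued measure on $\mathbb R^n$) is singular with respect to $n$-dimensional Lebesgue measure, that is, $E(\mathbb R^n\setminus Z)=0$ for some Borel set $Z$ of Lebesgue measure zero, then $k_\varphi(\tau)=0$. 2. There is a constant $C$, depending only on $p_1,\dots,p_n$ (and not on $\mathcal H$ or $\tau$), such that $k_\varphi(\tau)\le C\|\tau\|$ whenever $\tau$ has a cyclic vector. -/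

import Mathlib

open scoped NNReal ENNReal

universe u

noncomputable section

namespace HybridModulus

/-! ### Norming functions -/

/-- A (symmetric) norming function on the space of finitely supported real sequences. -/
structure NormingFunction where
  /-- the underlying function -/
  toFun : (ℕ →₀ ℝ) → ℝ
  pos : ∀ ξ, ξ ≠ 0 → 0 < toFun ξ
  smul : ∀ (a : ℝ) ξ, toFun (a • ξ) = |a| * toFun ξ
  add_le : ∀ ξ η, toFun (ξ + η) ≤ toFun ξ + toFun η
  single_one : toFun (Finsupp.single 0 1) = 1
  perm : ∀ (σ : Equiv.Perm ℕ) ξ, toFun (Finsupp.equivMapDomain σ ξ) = toFun ξ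

/-- The decreasing rearrangement `ξ*` of `|ξ|`, indexed from `0`: `ξ*_k` is the smallest `t ≥ 0`
such that at most `k` of the numbers `|ξ_j|` exceed `t`. -/
def rearrangement (ξ : ℕ →₀ ℝ) (k : ℕ) : ℝ :=
  sInf {t : ℝ | 0 ≤ t ∧ {j | t < |ξ j|}.ncard ≤ k}

/-- The function `Φ_π(ξ) = ∑_j π_j ξ*_j`. (The sum has only finitely many non-zero terms.) -/
def seqNorm (π : ℕ → ℝ) (ξ : ℕ →₀ ℝ) : ℝ := ∑' j, π j * rearrangement ξ j

theorem rearrangement_eq_of_antitone {ξ : ℕ →₀ ℝ} {σ : Equiv.Perm ℕ}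
    (h : Antitone fun j => |ξ (σ j)|) (k : ℕ) : rearrangement ξ k = |ξ (σ k)| := by
  have key : ∀ t : ℝ, {j | t < |ξ j|} = σ '' {j | t < |ξ (σ j)|} := by
    intro t
    ext j
    simp only [Set.mem_ofPred_eq, Set.mem_image]
    exact ⟨fun hj => ⟨σ.symm j, by simpa using hj, by simp⟩, by rintro ⟨i, hi, rfl⟩; exact hi⟩
  have card : ∀ t : ℝ, {j | t < |ξ j|}.ncard = {j | t < |ξ (σ j)|}.ncard := by
    intro t
    rw [key, Set.ncard_image_of_injective _ σ.injective]
  apply le_antisymm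
  · refine csInf_le ⟨0, fun t ht => ht.1⟩ ⟨abs_nonneg _, ?_⟩
    rw [card]
    have hsub : {j | |ξ (σ k)| < |ξ (σ j)|} ⊆ (Finset.range k : Set ℕ) := by
      intro j hj
      simp only [Finset.coe_range, Set.mem_Iio]
      by_contra hjk
      exact absurd (h (not_lt.mp hjk)) (not_le.mpr hj)
    calc _ ≤ (Finset.range k : Set ℕ).ncard := Set.ncard_le_ncard hsub (Finset.finite_toSet _)
      _ = k := by rw [Set.ncard_coe_finset, Finset.card_range]
  · refine le_csInf ⟨|ξ (σ 0)|, abs_nonneg _, ?_⟩ ?_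
    · rw [card]
      have : {j | |ξ (σ 0)| < |ξ (σ j)|} = ∅ := by
        ext j
        simpa using h (Nat.zero_le j)
      simp [this]
    · rintro t ⟨ht0, ht⟩
      by_contra hlt
      rw [not_le] at hlt
      rw [card] at ht
      have hfin : {j | t < |ξ (σ j)|}.Finite := by
        refine Set.Finite.subset ((ξ.support.finite_toSet).preimage σ.injective.injOn) ?_
        intro j hj
        simp only [Set.mem_preimage, Finset.mem_coe, Finsupp.mem_support_iff]
        intro h0
        simp only [Set.mem_ofPred_eq, h0, abs_zero] at hj
        linarith
      have hsub : (Finset.range (k + 1) : Set ℕ) ⊆ {j | t < |ξ (σ j)|} := by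
        intro j hj
        simp only [Finset.coe_range, Set.mem_Iio] at hj
        exact lt_of_lt_of_le hlt (h (Nat.lt_succ_iff.mp hj))
      have := Set.ncard_le_ncard hsub hfin
      rw [Set.ncard_coe_finset, Finset.card_range] at this
      omega

theorem exists_sorting (ξ : ℕ →₀ ℝ) {N : ℕ} (hN : ξ.support ⊆ Finset.range N) :
    ∃ σ : Equiv.Perm ℕ, {x | σ x ≠ x} ⊆ (Finset.range N : Set ℕ) ∧
      Antitone fun j => |ξ (σ j)| := by
  let g : Fin N → ℝ := fun i => -|ξ i|
  let σ : Equiv.Perm ℕ := (Tuple.sort g).extendDomain Fin.equivSubtype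
  have hlt : ∀ j (hj : j < N), σ j = (Tuple.sort g ⟨j, hj⟩ : Fin N) := by
    intro j hj
    have := Equiv.Perm.extendDomain_apply_subtype (Tuple.sort g) Fin.equivSubtype (b := j) hj
    simpa [σ] using this
  have hge : ∀ j, ¬ j < N → σ j = j := fun j hj =>
    Equiv.Perm.extendDomain_apply_not_subtype (Tuple.sort g) Fin.equivSubtype hj
  have hzero : ∀ j, ¬ j < N → ξ j = 0 := by
    intro j hj
    by_contra h0
    exact hj (Finset.mem_range.mp (hN (Finsupp.mem_support_iff.mpr h0)))
  refine ⟨σ, ?_, ?_⟩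
  · intro x hx
    simp only [Finset.coe_range, Set.mem_Iio]
    by_contra h
    exact hx (hge x h)
  · intro i j hij
    show |ξ (σ j)| ≤ |ξ (σ i)|
    by_cases hj : j < N
    · have hi : i < N := lt_of_le_of_lt hij hj
      rw [hlt i hi, hlt j hj]
      have hm := Tuple.monotone_sort g (a := ⟨i, hi⟩) (b := ⟨j, hj⟩) hij
      simp only [g, Function.comp_apply] at hm
      linarith
    · rw [hge j hj, hzero j hj, abs_zero]
      exact abs_nonneg _

theorem seqNorm_eq_sum (π : ℕ → ℝ) {ξ : ℕ →₀ ℝ} {N : ℕ} (hN : ξ.support ⊆ Finset.range N)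
    {σ : Equiv.Perm ℕ} (hσ : {x | σ x ≠ x} ⊆ (Finset.range N : Set ℕ))
    (h : Antitone fun j => |ξ (σ j)|) :
    seqNorm π ξ = ∑ j ∈ Finset.range N, π j * |ξ (σ j)| := by
  unfold seqNorm
  rw [tsum_eq_sum (s := Finset.range N)]
  · exact Finset.sum_congr rfl fun j _ => by rw [rearrangement_eq_of_antitone h]
  · intro j hj
    have h1 : σ j = j := by
      by_contra hne
      exact hj (by simpa using hσ hne)
    have h2 : ξ j = 0 := by
      by_contra h0
      exact hj (hN (Finsupp.mem_support_iff.mpr h0))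
    rw [rearrangement_eq_of_antitone h, h1, h2, abs_zero, mul_zero]

theorem sum_perm_le_seqNorm {π : ℕ → ℝ} (hπ : Antitone π) {ξ : ℕ →₀ ℝ} {N : ℕ}
    (hN : ξ.support ⊆ Finset.range N) {σ : Equiv.Perm ℕ}
    (hσ : {x | σ x ≠ x} ⊆ (Finset.range N : Set ℕ)) :
    ∑ j ∈ Finset.range N, π j * |ξ (σ j)| ≤ seqNorm π ξ := by
  obtain ⟨ρ, hρ, hanti⟩ := exists_sorting ξ hN
  rw [seqNorm_eq_sum π hN hρ hanti]
  have hmono : MonovaryOn π (fun j => |ξ (ρ j)|) (Finset.range N : Set ℕ) :=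
    (hπ.monovary hanti).monovaryOn _
  have hsupp : {x | (σ.trans ρ.symm) x ≠ x} ⊆ (Finset.range N : Set ℕ) := by
    intro x hx
    by_contra hxN
    have h1 : σ x = x := by
      by_contra hne
      exact hxN (hσ hne)
    have h2 : ρ x = x := by
      by_contra hne
      exact hxN (hρ hne)
    apply hx
    rw [Equiv.trans_apply, h1, Equiv.symm_apply_eq, h2]
  have := hmono.sum_mul_comp_perm_le_sum_mul hsupp
  simpa using this

/-- The norming function `Φ_π` of a decreasing sequence of positive numbers with first term `1`. -/
def seqNormingFunction (π : ℕ → ℝ) (hanti : Antitone π) (hpos : ∀ j, 0 < π j) (hone : π 0 = 1) :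
    NormingFunction where
  toFun := seqNorm π
  pos ξ hξ := by
    obtain ⟨N, hN⟩ := ξ.support.exists_nat_subset_range
    obtain ⟨σ, hσ, h⟩ := exists_sorting ξ hN
    rw [seqNorm_eq_sum π hN hσ h]
    obtain ⟨j, hj⟩ := Finsupp.ne_iff.mp hξ
    have hj' : ξ j ≠ 0 := by simpa using hj
    refine Finset.sum_pos' (fun i _ => mul_nonneg (hpos i).le (abs_nonneg _))
      ⟨σ.symm j, ?_, mul_pos (hpos _) (by simpa using hj')⟩
    by_contra hmem
    have h1 : σ (σ.symm j) = σ.symm j := by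
      by_contra hne
      exact hmem (by simpa using hσ hne)
    rw [Equiv.apply_symm_apply] at h1
    rw [← h1] at hmem
    exact hmem (hN (Finsupp.mem_support_iff.mpr hj'))
  smul a ξ := by
    obtain ⟨N, hN⟩ := ξ.support.exists_nat_subset_range
    obtain ⟨σ, hσ, h⟩ := exists_sorting ξ hN
    have hN' : (a • ξ).support ⊆ Finset.range N := Finsupp.support_smul.trans hN
    have h' : Antitone fun j => |(a • ξ) (σ j)| := by
      intro i j hij
      simpa [abs_mul] using mul_le_mul_of_nonneg_left (h hij) (abs_nonneg a)
    rw [seqNorm_eq_sum π hN hσ h, seqNorm_eq_sum π hN' hσ h', Finset.mul_sum]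
    refine Finset.sum_congr rfl fun j _ => ?_
    rw [Finsupp.smul_apply, smul_eq_mul, abs_mul]
    ring
  add_le ξ η := by
    obtain ⟨N, hN⟩ := (ξ.support ∪ η.support).exists_nat_subset_range
    have hξ : ξ.support ⊆ Finset.range N := Finset.subset_union_left.trans hN
    have hη : η.support ⊆ Finset.range N := Finset.subset_union_right.trans hN
    have hs : (ξ + η).support ⊆ Finset.range N := Finsupp.support_add.trans hN
    obtain ⟨σ, hσ, h⟩ := exists_sorting (ξ + η) hs
    rw [seqNorm_eq_sum π hs hσ h]
    calc _ ≤ ∑ j ∈ Finset.range N, (π j * |ξ (σ j)| + π j * |η (σ j)|) := by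
          refine Finset.sum_le_sum fun j _ => ?_
          rw [← mul_add]
          exact mul_le_mul_of_nonneg_left (abs_add_le _ _) (hpos j).le
      _ ≤ _ := by
          rw [Finset.sum_add_distrib]
          exact add_le_add (sum_perm_le_seqNorm hanti hξ hσ) (sum_perm_le_seqNorm hanti hη hσ)
  single_one := by
    have hN : (Finsupp.single 0 (1 : ℝ) : ℕ →₀ ℝ).support ⊆ Finset.range 1 :=
      Finsupp.support_single_subset.trans (by simp)
    have h : Antitone fun j => |(Finsupp.single 0 (1 : ℝ) : ℕ →₀ ℝ) ((1 : Equiv.Perm ℕ) j)| := by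
      intro i j hij
      rcases Nat.eq_zero_or_pos j with rfl | hj
      · obtain rfl : i = 0 := by omega
        exact le_rfl
      · simp [Finsupp.single_apply, hj.ne]
    rw [seqNorm_eq_sum π hN (by simp) h]
    simp [hone]
  perm σ ξ := by
    unfold seqNorm
    congr 1
    ext k
    congr 1
    unfold rearrangement
    congr 1
    ext t
    have : {j | t < |Finsupp.equivMapDomain σ ξ j|} = σ '' {j | t < |ξ j|} := by
      ext j
      simp [Finsupp.equivMapDomain_apply, Equiv.image_eq_preimage_symm]
    rw [Set.mem_ofPred_eq, Set.mem_ofPred_eq, this, Set.ncard_image_of_injective _ σ.injective]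

/-- The norming function `Φ_p^-` of the ideal `𝒞_p^-`, which is `Φ_π` for the sequence
`π_j = j^(-1 + 1/p)`, `j = 1, 2, …` (here shifted so that the index starts from `0`). -/
def lorentzMinus (p : ℝ) (hp : 1 < p) : NormingFunction :=
  seqNormingFunction (fun j => ((j : ℝ) + 1) ^ (-1 + 1 / p))
    (by
      intro i j hij
      have h1 : -1 + 1 / p ≤ 0 := by
        have : 1 / p ≤ 1 := (div_le_one (by linarith)).mpr hp.le
        linarith
      exact Real.rpow_le_rpow_of_nonpos (by positivity) (by gcongr) h1)
    (fun j => by positivity)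
    (by simp)

/-! ### Symmetric norms of operators -/

section Operators

variable {H : Type u} [NormedAddCommGroup H] [InnerProductSpace ℂ H]

/-- Operators of finite rank. -/
def IsFiniteRank (T : H →L[ℂ] H) : Prop := FiniteDimensional ℂ T.range

theorem IsFiniteRank.comp_left {T : H →L[ℂ] H} (hT : IsFiniteRank T) (S : H →L[ℂ] H) :
    IsFiniteRank (S * T) := by
  unfold IsFiniteRank at *
  have : (S * T).range = T.range.map S.toLinearMap := by
    ext x; simp
  rw [this]
  infer_instance

theorem IsFiniteRank.finiteDimensional_ker_orthogonal {T : H →L[ℂ] H} (hT : IsFiniteRank T) :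
    FiniteDimensional ℂ T.kerᗮ := by
  have : FiniteDimensional ℂ T.range := hT
  refine FiniteDimensional.of_injective (T.toLinearMap.rangeRestrict.domRestrict T.kerᗮ) ?_
  rw [← LinearMap.ker_eq_bot, LinearMap.ker_eq_bot']
  rintro ⟨x, hx⟩ h0
  have hk : x ∈ T.ker := by
    simpa [Subtype.ext_iff] using h0
  have : x ∈ T.ker ⊓ T.kerᗮ := ⟨hk, hx⟩
  rw [Submodule.inf_orthogonal_eq_bot] at this
  simpa using this

/-- The sequence `s₀ ≥ s₁ ≥ …` of singular values of a finite rank operator `T`: the eigenvalues of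
`(T^* T)^{1/2}` repeated according to multiplicity. As `T` vanishes on its kernel, the non-zero ones
are the singular values of the map `(ker T)ᗮ → range T` of finite-dimensional spaces; they are
followed by zeros. -/
def singularSeq (T : H →L[ℂ] H) (hT : IsFiniteRank T) : ℕ →₀ ℝ :=
  haveI : FiniteDimensional ℂ T.range := hT
  haveI : FiniteDimensional ℂ T.kerᗮ := hT.finiteDimensional_ker_orthogonal
  (T.toLinearMap.rangeRestrict.domRestrict T.kerᗮ).singularValues

variable [CompleteSpace H]

/-- The finite rank orthogonal (hermitian) projections. -/
abbrev FinProj (H : Type u) [NormedAddCommGroup H] [InnerProductSpace ℂ H] [CompleteSpace H] :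
    Type u :=
  {P : H →L[ℂ] H // IsStarProjection P ∧ IsFiniteRank P}

/-- The finite rank positive contractions, with the natural (Loewner) order. -/
abbrev FinPosContr (H : Type u) [NormedAddCommGroup H] [InnerProductSpace ℂ H] : Type u :=
  {A : H →L[ℂ] H // IsFiniteRank A ∧ 0 ≤ A ∧ A ≤ 1}

/-- The norm `|T|_Φ = sup_P Φ(s(T P))` over the finite rank projections `P`, for a bounded operator
`T`, with values in `[0, ∞]`. -/
def opNorm (Φ : NormingFunction) (T : H →L[ℂ] H) : ℝ≥0∞ :=
  ⨆ P : FinProj H, ENNReal.ofReal (Φ.toFun (singularSeq (T * P.1) (P.2.2.comp_left T)))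

/-- The norm `|τ|_φ = max_j |τ(j)|_{φ(j)}` of an `n`-tuple of operators. -/
def tupleNorm {n : ℕ} (φ : Fin n → NormingFunction) (τ : Fin n → H →L[ℂ] H) : ℝ≥0∞ :=
  ⨆ j, opNorm (φ j) (τ j)

/-- The hybrid modulus of quasicentral approximation `k_φ(τ) = liminf_A |[τ, A]|_φ`, the lower limit
being along the directed set of finite rank positive contractions. -/
def quasicentralModulus {n : ℕ} (φ : Fin n → NormingFunction) (τ : Fin n → H →L[ℂ] H) : ℝ≥0∞ :=
  Filter.liminf (fun A : FinPosContr H => tupleNorm φ (fun j => ⁅τ j, A.1⁆)) Filter.atTop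

/-! ### Commuting hermitian tuples and their spectral measure -/

/-- An `n`-tuple of commuting hermitian operators. -/
structure IsCommutingHermitian {n : ℕ} (τ : Fin n → H →L[ℂ] H) : Prop where
  isSelfAdjoint : ∀ j, IsSelfAdjoint (τ j)
  commute : ∀ i j, Commute (τ i) (τ j)

/-- The vector `ξ` is cyclic for `τ` if the vectors `q(τ) ξ`, `q` running over the polynomials in
`τ(1), …, τ(n)`, are dense. -/
def IsCyclicVector {n : ℕ} (τ : Fin n → H →L[ℂ] H) (ξ : H) : Prop :=
  Dense {x : H | ∃ a ∈ Algebra.adjoin ℂ (Set.range τ), a ξ = x}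

/-- The unital C*-algebra generated by `τ`. -/
def generatedAlgebra {n : ℕ} (τ : Fin n → H →L[ℂ] H) : StarSubalgebra ℂ (H →L[ℂ] H) :=
  (StarAlgebra.adjoin ℂ (Set.range τ)).topologicalClosure

theorem mem_generatedAlgebra {n : ℕ} (τ : Fin n → H →L[ℂ] H) (j : Fin n) :
    τ j ∈ generatedAlgebra τ :=
  StarSubalgebra.le_topologicalClosure _ (StarAlgebra.subset_adjoin ℂ _ ⟨j, rfl⟩)

theorem generatedAlgebra_mul_comm {n : ℕ} {τ : Fin n → H →L[ℂ] H} (hτ : IsCommutingHermitian τ)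
    (x y : generatedAlgebra τ) : x * y = y * x := by
  have h1 : ∀ a ∈ Set.range τ, ∀ b ∈ Set.range τ, a * b = b * a := by
    rintro _ ⟨i, rfl⟩ _ ⟨j, rfl⟩
    exact hτ.commute i j
  have h2 : ∀ a ∈ Set.range τ, ∀ b ∈ Set.range τ, a * star b = star b * a := by
    rintro _ ⟨i, rfl⟩ _ ⟨j, rfl⟩
    rw [(hτ.isSelfAdjoint j).star_eq]
    exact hτ.commute i j
  have := StarAlgebra.isMulCommutative_adjoin ℂ h1 h2
  let _ := StarSubalgebra.commRingTopologicalClosure (StarAlgebra.adjoin ℂ (Set.range τ))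
    (fun a b => mul_comm' a b)
  exact mul_comm (G := (StarAlgebra.adjoin ℂ (Set.range τ)).topologicalClosure) x y

/-- The C*-algebra generated by a commuting hermitian tuple is a commutative C*-algebra. -/
abbrev commCStarAlgebra {n : ℕ} {τ : Fin n → H →L[ℂ] H} (hτ : IsCommutingHermitian τ) :
    CommCStarAlgebra (generatedAlgebra τ) :=
  { StarSubalgebra.cstarAlgebra (generatedAlgebra τ)
      (h_closed := StarSubalgebra.isClosed_topologicalClosure _) with
    mul_comm := generatedAlgebra_mul_comm hτ }

section FunctionalCalculus

variable {n : ℕ} {τ : Fin n → H →L[ℂ] H}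

open WeakDual in
/-- The map `χ ↦ (χ(τ(1)), …, χ(τ(n)))` from the Gelfand spectrum of the C*-algebra generated by `τ`
to `ℝⁿ`; its image is the joint spectrum of `τ`. -/
def jointSpectrumMap (hτ : IsCommutingHermitian τ) :
    letI := commCStarAlgebra hτ
    C(characterSpace ℂ (generatedAlgebra τ), Fin n → ℝ) :=
  letI := commCStarAlgebra hτ
  { toFun := fun χ j => (χ ⟨τ j, mem_generatedAlgebra τ j⟩).re
    continuous_toFun := by
      refine continuous_pi fun j => Complex.continuous_re.comp ?_
      exact (WeakDual.eval_continuous _).comp continuous_subtype_val }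

/-- The continuous functional calculus `f ↦ f(τ)` of a commuting hermitian tuple, obtained from the
Gelfand isomorphism. -/
def jointCfc (hτ : IsCommutingHermitian τ) : C(Fin n → ℝ, ℂ) →⋆ₐ[ℂ] (H →L[ℂ] H) :=
  letI := commCStarAlgebra hτ
  ((generatedAlgebra τ).subtype.comp
    (gelfandStarTransform (generatedAlgebra τ)).symm.toStarAlgHom).comp
    (ContinuousMap.compStarAlgHom' ℂ ℂ (jointSpectrumMap hτ))

/-- The functional calculus sends the `j`-th coordinate function to `τ(j)`. -/
theorem jointCfc_coord (hτ : IsCommutingHermitian τ) (j : Fin n) :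
    jointCfc hτ ⟨fun x => (x j : ℂ), by fun_prop⟩ = τ j := by
  let _ := commCStarAlgebra hτ
  have key : ContinuousMap.compStarAlgHom' ℂ ℂ (jointSpectrumMap hτ)
      ⟨fun x => (x j : ℂ), by fun_prop⟩ =
      gelfandStarTransform (generatedAlgebra τ) ⟨τ j, mem_generatedAlgebra τ j⟩ := by
    ext χ
    have hsa : IsSelfAdjoint (⟨τ j, mem_generatedAlgebra τ j⟩ : generatedAlgebra τ) :=
      Subtype.ext (hτ.isSelfAdjoint j)
    have hreal : star (χ ⟨τ j, mem_generatedAlgebra τ j⟩) = χ ⟨τ j, mem_generatedAlgebra τ j⟩ := by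
      rw [← map_star, hsa.star_eq]
    exact Complex.conj_eq_iff_re.mp hreal
  show (generatedAlgebra τ).subtype ((gelfandStarTransform (generatedAlgebra τ)).symm
    (ContinuousMap.compStarAlgHom' ℂ ℂ (jointSpectrumMap hτ) _)) = τ j
  rw [key, StarAlgEquiv.symm_apply_apply]
  rfl

open CompactlySupported

/-- A real continuous function with compact support, as a complex continuous function. -/
def toComplex (f : C_c(Fin n → ℝ, ℝ)) : C(Fin n → ℝ, ℂ) := ⟨fun x => (f x : ℂ), by fun_prop⟩

/-- The positive linear functional `f ↦ ⟨f(τ) ξ, ξ⟩`. -/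
def spectralFunctional (hτ : IsCommutingHermitian τ) (ξ : H) : C_c(Fin n → ℝ, ℝ) →ₚ[ℝ] ℝ :=
  PositiveLinearMap.mk₀
    { toFun := fun f => (inner ℂ ξ (jointCfc hτ (toComplex f) ξ)).re
      map_add' := by
        intro f g
        have : toComplex (f + g) = toComplex f + toComplex g := by
          ext x; simp [toComplex]
        simp [this]
      map_smul' := by
        intro c f
        have : toComplex (c • f) = (c : ℂ) • toComplex f := by
          ext x; simp [toComplex]
        simp [this] }
    (by
      intro f hf
      let g : C(Fin n → ℝ, ℂ) := ⟨fun x => (Real.sqrt (f x) : ℂ), by fun_prop⟩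
      have hg : toComplex f = star g * g := by
        ext x
        have h0 : 0 ≤ f x := hf x
        simp only [toComplex, g, ContinuousMap.coe_mk, ContinuousMap.mul_apply,
          ContinuousMap.star_apply, RCLike.star_def, Complex.conj_ofReal]
        rw [← Complex.ofReal_mul, Real.mul_self_sqrt h0]
      show 0 ≤ (inner ℂ ξ (jointCfc hτ (toComplex f) ξ)).re
      rw [hg, map_mul, map_star, ContinuousLinearMap.star_eq_adjoint,
        mul_apply_eq_comp, ContinuousLinearMap.adjoint_inner_right]
      exact inner_self_nonneg (𝕜 := ℂ))

/-- The scalar spectral measure `B ↦ ⟨E(B) ξ, ξ⟩` of `τ` at `ξ`, where `E` is the spectral measure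
of `τ`: the regular Borel measure on `ℝⁿ` with `∫ f = ⟨f(τ) ξ, ξ⟩`. -/
def scalarSpectralMeasure (hτ : IsCommutingHermitian τ) (ξ : H) :
    MeasureTheory.Measure (Fin n → ℝ) :=
  RealRMK.rieszMeasure (spectralFunctional hτ ξ)

theorem integral_scalarSpectralMeasure (hτ : IsCommutingHermitian τ) (ξ : H)
    (f : C_c(Fin n → ℝ, ℝ)) :
    ∫ x, f x ∂(scalarSpectralMeasure hτ ξ) = (inner ℂ ξ (jointCfc hτ (toComplex f) ξ)).re :=
  RealRMK.integral_rieszMeasure _ f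

/-- The spectral measure `E` of `τ` is singular with respect to Lebesgue measure: it is carried by a
Lebesgue null set `Z`, that is `E(Zᶜ) = 0`, or `⟨E(Zᶜ) ξ, ξ⟩ = 0` for all `ξ`. -/
def HasSingularSpectralMeasure (hτ : IsCommutingHermitian τ) : Prop :=
  ∃ Z : Set (Fin n → ℝ), MeasurableSet Z ∧ MeasureTheory.volume Z = 0 ∧
    ∀ ξ : H, scalarSpectralMeasure hτ ξ Zᶜ = 0

end FunctionalCalculus

end Operators

end HybridModulus

end

/-!
# The hybrid modulus of quasicentral approximation of commuting hermitian tuples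

The modulus is estimated from above by means of explicit projections. Divide the ball of radius
`‖τ‖` of `ℝⁿ` (a cube, for the supremum norm) into boxes with sides `t^{-1/p_j}`. As
`∑ 1 / p_j = 1`, such a box has volume `1 / t`, and there are at most a constant times `t` of them.
Given vectors `h_1, …, h_m`, let `Q` be the projection onto the span of the vectors `E(B) h_i`,
where `B` runs over a family of `N` boxes and `E` is the spectral measure. On the range of `E(B)` the
operator `τ j` is a scalar up to an error `t^{-1/p_j}`, and different boxes give orthogonal vectors;
so `[τ j, Q]` has norm `O(t^{-1/p_j})` and rank at most `2 m N`, and its norm in the ideal is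
`O(t^{-1/p_j} (m N)^{1/p_j})`, because `∑_{i ≤ L} i^{-1 + 1/p} ≤ p L^{1/p}`.

* If `ξ` is cyclic, take all boxes and the single vector `ξ`: then `m = 1` and `N = O(t)`, which
  gives a bound independent of `t`, and `Q` tends strongly to `1` as `t → ∞`.
* If the spectral measure is carried by a null set, take the boxes that meet a null compact set `K`
  carrying almost all of the measures `⟨E(·) h_i, h_i⟩`. Their total volume `N / t` is at most the
  volume of a thickening of `K`, hence tends to `0`, and so does the bound, for every `m`.

The projections `E(B)` are avoided: `E(B)` is replaced by `f_B(τ)` for a continuous `f_B`, equal to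
`1` on most of `B` and supported near `B`, where the functions of different boxes have product zero
(`exists_submodule_of_disjoint_functions`, `exists_submodule_of_cells`).

The lower limit in the modulus asks for operators `A` above a given finite rank contraction `A₀`,
while `Q` only almost fixes the range of `A₀`. It is corrected by a perturbation of rank bounded in
terms of `A₀` alone and of small operator norm (`exists_finPosContr_ge`), which does not affect the
estimates (`opNorm_lorentzMinus_add_le`, `quasicentralModulus_le_of_forall_exists_projection`).
-/

/-! ### Singular values and partial sums of powers -/

open Module in
/-- The half of the min-max principle that is needed: a bound for `T` on the kernel of a map of rank
at most `k` is a bound for the singular value with index `k` (counting from `0`). -/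
theorem LinearMap.singularValues_le_of_forall_ker {𝕜 E F G : Type*} [RCLike 𝕜]
    [NormedAddCommGroup E] [InnerProductSpace 𝕜 E] [FiniteDimensional 𝕜 E]
    [NormedAddCommGroup F] [InnerProductSpace 𝕜 F] [FiniteDimensional 𝕜 F]
    [AddCommGroup G] [Module 𝕜 G] (T : E →ₗ[𝕜] F) (R : E →ₗ[𝕜] G) {k : ℕ}
    (hk : finrank 𝕜 R.range ≤ k) {c : ℝ} (hc : 0 ≤ c)
    (h : ∀ x, R x = 0 → ‖T x‖ ≤ c * ‖x‖) : T.singularValues k ≤ c := by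
  rcases le_or_gt (finrank 𝕜 E) k with hE | hE
  · rwa [T.singularValues_of_finrank_le hE]
  set hT := T.isSymmetric_adjoint_comp_self
  set b := hT.eigenvectorBasis rfl
  have hkE : k + 1 ≤ finrank 𝕜 E := hE
  let v : Fin (k + 1) → E := fun i => b (Fin.castLE hkE i)
  have hv : Orthonormal 𝕜 v := b.orthonormal.comp _ (Fin.castLE_injective hkE)
  -- the span of the first `k + 1` eigenvectors meets the kernel of `R`, for dimensional reasons
  obtain ⟨a, ha, ha0⟩ : ∃ a : Fin (k + 1) → 𝕜, R.rangeRestrict (∑ i, a i • v i) = 0 ∧ a ≠ 0 := by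
    have hlt : finrank 𝕜 R.range < finrank 𝕜 (Fin (k + 1) → 𝕜) := by
      rw [Module.finrank_fin_fun]; omega
    obtain ⟨a, ha, ha0⟩ := Submodule.exists_mem_ne_zero_of_ne_bot
      (LinearMap.ker_ne_bot_of_finrank_lt
        (f := R.rangeRestrict ∘ₗ Fintype.linearCombination 𝕜 v) hlt)
    exact ⟨a, by rw [← Fintype.linearCombination_apply 𝕜]; exact ha, ha0⟩
  set x := ∑ i, a i • v i with hx
  have hRx : R x = 0 := by simpa [Subtype.ext_iff] using ha
  have hnx : ‖x‖ ^ 2 = ∑ i, ‖a i‖ ^ 2 := by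
    rw [← @inner_self_eq_norm_sq 𝕜, hx, hv.inner_sum, map_sum]
    refine Finset.sum_congr rfl fun i _ => ?_
    rw [RCLike.conj_mul, ← RCLike.ofReal_pow, RCLike.ofReal_re]
  have hx0 : 0 < ‖x‖ ^ 2 := by
    rw [hnx]
    obtain ⟨i, hi⟩ := Function.ne_iff.mp ha0
    exact Finset.sum_pos' (fun _ _ => by positivity)
      ⟨i, Finset.mem_univ _, by have : a i ≠ 0 := hi; positivity⟩
  have hTx : ‖T x‖ ^ 2 = ∑ i, hT.eigenvalues rfl (Fin.castLE hkE i) * ‖a i‖ ^ 2 := by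
    have h1 : (T.adjoint ∘ₗ T) x =
        ∑ i, (a i * (hT.eigenvalues rfl (Fin.castLE hkE i) : 𝕜)) • v i := by
      rw [hx, map_sum]
      refine Finset.sum_congr rfl fun i _ => ?_
      rw [map_smul, hT.apply_eigenvectorBasis rfl, smul_smul]
    have h2 : inner 𝕜 x ((T.adjoint ∘ₗ T) x) = inner 𝕜 (T x) (T x) := by
      rw [LinearMap.comp_apply, LinearMap.adjoint_inner_right]
    rw [← @inner_self_eq_norm_sq 𝕜, ← h2, h1, hx, hv.inner_sum, map_sum]
    refine Finset.sum_congr rfl fun i _ => ?_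
    rw [← mul_assoc, RCLike.conj_mul, ← RCLike.ofReal_pow, ← RCLike.ofReal_mul, RCLike.ofReal_re,
      mul_comm]
  have hlow : T.singularValues k ^ 2 * ‖x‖ ^ 2 ≤ ‖T x‖ ^ 2 := by
    rw [hTx, hnx, Finset.mul_sum, T.sq_singularValues_of_lt rfl hE]
    refine Finset.sum_le_sum fun i _ => ?_
    gcongr
    exact hT.eigenvalues_antitone rfl (Fin.le_def.mpr (Nat.lt_succ_iff.mp i.2))
  have hup : ‖T x‖ ^ 2 ≤ c ^ 2 * ‖x‖ ^ 2 := by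
    rw [← mul_pow]
    gcongr
    exact h x hRx
  exact le_of_sq_le_sq (le_of_mul_le_mul_right (hlow.trans hup) hx0) hc

theorem Real.sum_range_rpow_le {p : ℝ} (hp : 1 < p) (L : ℕ) :
    ∑ i ∈ Finset.range L, ((i : ℝ) + 1) ^ (-1 + 1 / p) ≤ p * (L : ℝ) ^ (1 / p) := by
  have hp0 : 0 < p := by linarith
  induction L with
  | zero => simp [hp0.ne']
  | succ L ih =>
    rw [Finset.sum_range_succ]
    have hL : (0 : ℝ) < (L : ℝ) + 1 := by positivity
    -- Bernoulli's inequality for the exponent `1 / p ≤ 1`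
    have hB : (1 + -(1 / ((L : ℝ) + 1))) ^ (1 / p) ≤ 1 + 1 / p * -(1 / ((L : ℝ) + 1)) := by
      refine rpow_one_add_le_one_add_mul_self ?_ (by positivity) ?_
      · rw [neg_le_neg_iff, div_le_one hL]; simp
      · rw [div_le_one hp0]; exact hp.le
    have h1 : (L : ℝ) ^ (1 / p) =
        ((L : ℝ) + 1) ^ (1 / p) * (1 + -(1 / ((L : ℝ) + 1))) ^ (1 / p) := by
      rw [← Real.mul_rpow hL.le]
      · congr 1; field_simp; ring
      · have : 1 / ((L : ℝ) + 1) ≤ 1 := by rw [div_le_one hL]; simp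
        linarith
    have h2 : ((L : ℝ) + 1) ^ (-1 + 1 / p) = ((L : ℝ) + 1) ^ (1 / p) * (1 / ((L : ℝ) + 1)) := by
      rw [Real.rpow_add hL, Real.rpow_neg_one]; ring
    have h3 := mul_le_mul_of_nonneg_left hB (Real.rpow_nonneg hL.le (1 / p))
    rw [← h1] at h3
    rw [h2]
    push_cast
    calc _ ≤ p * (((L : ℝ) + 1) ^ (1 / p) * (1 + 1 / p * -(1 / ((L : ℝ) + 1)))) +
          ((L : ℝ) + 1) ^ (1 / p) * (1 / ((L : ℝ) + 1)) := by
          gcongr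
          exact ih.trans (mul_le_mul_of_nonneg_left h3 hp0.le)
      _ = _ := by field_simp; ring

namespace HybridModulus

/-! ### Norms of operators of finite rank -/

section FiniteRankNorms

theorem seqNorm_eq_sum_of_antitone (π : ℕ → ℝ) {ξ : ℕ →₀ ℝ} (h0 : ∀ k, 0 ≤ ξ k)
    (h : Antitone ξ) {N : ℕ} (hN : ∀ k, N ≤ k → ξ k = 0) :
    seqNorm π ξ = ∑ j ∈ Finset.range N, π j * ξ j := by
  have := seqNorm_eq_sum π (ξ := ξ) (N := N) (σ := 1) (by
      intro k hk
      by_contra hkN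
      exact (Finsupp.mem_support_iff.mp hk) (hN k (by simpa using hkN)))
    (by simp) (by intro i j hij; simpa [abs_of_nonneg (h0 _)] using h hij)
  simpa [abs_of_nonneg (h0 _)] using this

variable {H : Type u} [NormedAddCommGroup H] [InnerProductSpace ℂ H]

theorem singularSeq_nonneg {T : H →L[ℂ] H} (hT : IsFiniteRank T) (k : ℕ) :
    0 ≤ singularSeq T hT k := by
  have : FiniteDimensional ℂ T.range := hT
  have : FiniteDimensional ℂ T.kerᗮ := hT.finiteDimensional_ker_orthogonal
  exact LinearMap.singularValues_nonneg _ k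

theorem singularSeq_antitone {T : H →L[ℂ] H} (hT : IsFiniteRank T) :
    Antitone (singularSeq T hT) := by
  have : FiniteDimensional ℂ T.range := hT
  have : FiniteDimensional ℂ T.kerᗮ := hT.finiteDimensional_ker_orthogonal
  exact LinearMap.singularValues_antitone _

theorem finrank_range_le_of_rank_le {V W : Type*} [AddCommGroup V] [Module ℂ V]
    [AddCommGroup W] [Module ℂ W] {R : V →ₗ[ℂ] W}
    {k : ℕ} (hR : R.rank ≤ k) : Module.finrank ℂ R.range ≤ k :=
  Module.finrank_le_of_rank_le hR

/-- Singular values are bounded by approximation numbers. -/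
theorem singularSeq_le_norm_sub {T R : H →L[ℂ] H} (hT : IsFiniteRank T) {k : ℕ}
    (hR : R.toLinearMap.rank ≤ k) : singularSeq T hT k ≤ ‖T - R‖ := by
  have : FiniteDimensional ℂ T.range := hT
  have : FiniteDimensional ℂ T.kerᗮ := hT.finiteDimensional_ker_orthogonal
  refine LinearMap.singularValues_le_of_forall_ker _ (R.toLinearMap ∘ₗ T.kerᗮ.subtype)
    (finrank_range_le_of_rank_le ((LinearMap.rank_comp_le_left _ _).trans hR)) (norm_nonneg _) ?_
  intro x hx
  have hx' : R x = 0 := hx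
  have := (T - R).le_opNorm x
  rw [_root_.sub_apply, hx', sub_zero] at this
  exact this

variable [CompleteSpace H]

/-- The norm of an operator `S` of rank `L` perturbed by an operator `R` of rank `r`: the first `r`
singular values are at most `‖S‖ + ‖R‖`, the following `L` are at most `‖S‖`, the rest vanish. This
replaces the triangle inequality for `|·|_Φ`. -/
theorem opNorm_lorentzMinus_add_le {p : ℝ} (hp : 1 < p) {S R : H →L[ℂ] H} {L r : ℕ}
    (hS : S.toLinearMap.rank ≤ L) (hR : R.toLinearMap.rank ≤ r) :
    opNorm (lorentzMinus p hp) (S + R) ≤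
      ENNReal.ofReal (‖S‖ * (p * (L : ℝ) ^ (1 / p) + r) + ‖R‖ * r) := by
  refine iSup_le fun P => ENNReal.ofReal_le_ofReal ?_
  have hP : ‖P.1‖ ≤ 1 := IsStarProjection.norm_le P.1 P.2.1
  have hT := P.2.2.comp_left (S + R)
  set T := (S + R) * P.1 with hTdef
  have hmul : ∀ A : H →L[ℂ] H, ‖A * P.1‖ ≤ ‖A‖ := fun A =>
    (norm_mul_le _ _).trans (mul_le_of_le_one_right (norm_nonneg _) hP)
  have hrank : ∀ {A : H →L[ℂ] H} {k : ℕ}, A.toLinearMap.rank ≤ k →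
      (A * P.1).toLinearMap.rank ≤ k := fun {A k} hA =>
    (LinearMap.rank_comp_le_left P.1.toLinearMap A.toLinearMap).trans hA
  have hTsplit : T = S * P.1 + R * P.1 := add_mul _ _ _
  have hs1 : ∀ k, singularSeq T hT k ≤ ‖S‖ + ‖R‖ := fun k => by
    refine (singularSeq_le_norm_sub hT (R := 0) (k := k) ?_).trans ?_
    · have : (0 : H →L[ℂ] H).toLinearMap.rank = 0 := LinearMap.rank_zero
      rw [this]; exact zero_le
    · rw [sub_zero, hTsplit]
      exact (norm_add_le _ _).trans (add_le_add (hmul _) (hmul _))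
  have hs2 : ∀ k, r ≤ k → singularSeq T hT k ≤ ‖S‖ := fun k hk => by
    refine (singularSeq_le_norm_sub hT (R := R * P.1) (k := k) ?_).trans ?_
    · exact (hrank hR).trans (by exact_mod_cast hk)
    · rw [hTsplit, add_sub_cancel_right]; exact hmul _
  have hs3 : ∀ k, L + r ≤ k → singularSeq T hT k = 0 := fun k hk => by
    refine le_antisymm ((singularSeq_le_norm_sub hT (R := T) (k := k) ?_).trans (by simp))
      (singularSeq_nonneg _ _)
    calc T.toLinearMap.rank ≤ (S * P.1).toLinearMap.rank + (R * P.1).toLinearMap.rank := by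
          rw [hTsplit]; exact LinearMap.rank_add_le _ _
      _ ≤ (L : Cardinal) + r := add_le_add (hrank hS) (hrank hR)
      _ ≤ k := by exact_mod_cast hk
  change seqNorm _ _ ≤ _
  rw [seqNorm_eq_sum_of_antitone _ (singularSeq_nonneg hT) (singularSeq_antitone hT) hs3]
  set π : ℕ → ℝ := fun j => ((j : ℝ) + 1) ^ (-1 + 1 / p)
  have hπ0 : ∀ j, 0 ≤ π j := fun j => by positivity
  have hπ1 : ∀ j, π j ≤ 1 := fun j => by
    refine Real.rpow_le_one_of_one_le_of_nonpos (by simp) ?_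
    have : 1 / p ≤ 1 := (div_le_one (by linarith)).mpr hp.le
    linarith
  have hterm : ∀ j, π j * singularSeq T hT j ≤ π j * ‖S‖ + if j < r then ‖R‖ else 0 := fun j => by
    split_ifs with hj
    · calc _ ≤ π j * (‖S‖ + ‖R‖) := by exact mul_le_mul_of_nonneg_left (hs1 j) (hπ0 j)
        _ ≤ _ := by
          rw [mul_add]; gcongr; exact mul_le_of_le_one_left (norm_nonneg _) (hπ1 j)
    · rw [add_zero]; exact mul_le_mul_of_nonneg_left (hs2 j (not_lt.mp hj)) (hπ0 j)
  calc ∑ j ∈ Finset.range (L + r), π j * singularSeq T hT j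
      ≤ ∑ j ∈ Finset.range (L + r), (π j * ‖S‖ + if j < r then ‖R‖ else 0) :=
        Finset.sum_le_sum fun j _ => hterm j
    _ = ‖S‖ * ∑ j ∈ Finset.range (L + r), π j + ‖R‖ * r := by
        rw [Finset.sum_add_distrib, ← Finset.sum_mul, mul_comm, ← Finset.sum_filter]
        have : (Finset.range (L + r)).filter (· < r) = Finset.range r := by ext; simp; omega
        rw [this]; simp [mul_comm]
    _ ≤ _ := by
        gcongr
        rw [Finset.sum_range_add]
        refine add_le_add (Real.sum_range_rpow_le hp L) ?_
        calc _ ≤ ∑ j ∈ Finset.range r, (1 : ℝ) := Finset.sum_le_sum fun j _ => hπ1 _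
          _ = r := by simp

end FiniteRankNorms

/-! ### Quasicentral approximation by projections -/

section Projections

variable {H : Type u} [NormedAddCommGroup H] [InnerProductSpace ℂ H]

theorem isFiniteRank_of_rank_le {T : H →L[ℂ] H} {k : ℕ} (h : T.toLinearMap.rank ≤ k) :
    IsFiniteRank T :=
  Module.rank_lt_aleph0_iff.mp (h.trans_lt Cardinal.natCast_lt_aleph0)

theorem rank_add_le {S T : H →L[ℂ] H} {k l : ℕ} (hS : S.toLinearMap.rank ≤ k)
    (hT : T.toLinearMap.rank ≤ l) : (S + T).toLinearMap.rank ≤ (k + l : ℕ) := by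
  push_cast
  exact (LinearMap.rank_add_le S.toLinearMap T.toLinearMap).trans (add_le_add hS hT)

theorem rank_neg_le {S : H →L[ℂ] H} {k : ℕ} (hS : S.toLinearMap.rank ≤ k) :
    (-S).toLinearMap.rank ≤ k := by
  rw [← mul_neg_one]
  exact (LinearMap.rank_comp_le_left (-1 : H →L[ℂ] H).toLinearMap S.toLinearMap).trans hS

theorem rank_mul_right_le {S : H →L[ℂ] H} {k : ℕ} (hS : S.toLinearMap.rank ≤ k) (T : H →L[ℂ] H) :
    (S * T).toLinearMap.rank ≤ k :=
  (LinearMap.rank_comp_le_left T.toLinearMap S.toLinearMap).trans hS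

theorem rank_mul_left_le {S : H →L[ℂ] H} {k : ℕ} (hS : S.toLinearMap.rank ≤ k) (T : H →L[ℂ] H) :
    (T * S).toLinearMap.rank ≤ k := by
  have := LinearMap.lift_rank_comp_le_right S.toLinearMap T.toLinearMap
  rw [Cardinal.lift_id, Cardinal.lift_id] at this
  exact this.trans hS

theorem rank_lie_le {S : H →L[ℂ] H} {k : ℕ} (hS : S.toLinearMap.rank ≤ k) (T : H →L[ℂ] H) :
    ⁅T, S⁆.toLinearMap.rank ≤ (k + k : ℕ) := by
  rw [Ring.lie_def, sub_eq_add_neg]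
  exact rank_add_le (rank_mul_left_le hS T) (rank_neg_le (rank_mul_right_le hS T))

theorem rank_starProjection_le (K : Submodule ℂ H) [FiniteDimensional ℂ K] :
    K.starProjection.toLinearMap.rank ≤ (Module.finrank ℂ K : ℕ) := by
  rw [LinearMap.rank, Submodule.range_starProjection, Module.finrank_eq_rank]

theorem norm_mul_starProjection_le (K : Submodule ℂ H) [FiniteDimensional ℂ K] (T : H →L[ℂ] H)
    {δ : ℝ} (hδ : 0 ≤ δ) (h : ∀ i, ‖T (stdOrthonormalBasis ℂ K i)‖ ≤ δ) :
    ‖T * K.starProjection‖ ≤ Module.finrank ℂ K * δ := by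
  set e := stdOrthonormalBasis ℂ K
  refine ContinuousLinearMap.opNorm_le_bound _ (by positivity) fun x => ?_
  have hx : K.starProjection x = ∑ i, inner ℂ (e i : H) x • (e i : H) := by
    rw [Submodule.starProjection_apply, e.orthogonalProjectionOnto_apply_eq_sum]
    simp
  change ‖T (K.starProjection x)‖ ≤ _
  rw [hx, map_sum]
  calc _ ≤ ∑ i, ‖T (inner ℂ (e i : H) x • (e i : H))‖ := norm_sum_le _ _
    _ ≤ ∑ i : Fin (Module.finrank ℂ K), δ * ‖x‖ := by
        refine Finset.sum_le_sum fun i _ => ?_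
        rw [map_smul, norm_smul, mul_comm]
        have h1 : ‖(inner ℂ (e i : H) x : ℂ)‖ ≤ ‖x‖ := by
          have h2 : ‖(e i : H)‖ = 1 := e.orthonormal.1 i
          simpa [h2] using norm_inner_le_norm (𝕜 := ℂ) (e i : H) x
        exact mul_le_mul (h i) h1 (norm_nonneg _) hδ
    _ = _ := by simp [mul_assoc]

theorem norm_lie_le (S T : H →L[ℂ] H) : ‖⁅S, T⁆‖ ≤ 2 * (‖S‖ * ‖T‖) := by
  rw [Ring.lie_def]
  calc _ ≤ ‖S * T‖ + ‖T * S‖ := norm_sub_le _ _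
    _ ≤ ‖S‖ * ‖T‖ + ‖T‖ * ‖S‖ := add_le_add (norm_mul_le _ _) (norm_mul_le _ _)
    _ = _ := by ring

variable [CompleteSpace H]

theorem le_starProjection_of_range_le {A : H →L[ℂ] H} (h0 : 0 ≤ A) (h1 : A ≤ 1)
    {K : Submodule ℂ H} [K.HasOrthogonalProjection] (hK : A.range ≤ K) :
    A ≤ K.starProjection := by
  set P := K.starProjection
  have hP : IsStarProjection P := isStarProjection_starProjection
  have hPA : P * A = A := by
    ext x
    exact Submodule.starProjection_eq_self_iff.mpr (hK ⟨x, rfl⟩)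
  have hAP : A * P = A := by
    have := congrArg star hPA
    rwa [star_mul, hP.isSelfAdjoint.star_eq, (IsSelfAdjoint.of_nonneg h0).star_eq] at this
  calc A = P * A * P := by rw [hPA, hAP]
    _ ≤ P * 1 * P := hP.isSelfAdjoint.conjugate_le_conjugate h1
    _ = P := by rw [mul_one]; exact hP.isIdempotentElem

instance : IsDirectedOrder (FinPosContr H) where
  directed A B := by
    have hA : FiniteDimensional ℂ A.1.range := A.2.1
    have hB : FiniteDimensional ℂ B.1.range := B.2.1
    have hP := isStarProjection_starProjection (U := A.1.range ⊔ B.1.range)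
    exact ⟨⟨(A.1.range ⊔ B.1.range).starProjection,
      isFiniteRank_of_rank_le (rank_starProjection_le _), hP.nonneg, hP.le_one⟩,
      le_starProjection_of_range_le A.2.2.1 A.2.2.2 le_sup_left,
      le_starProjection_of_range_le B.2.2.1 B.2.2.2 le_sup_right⟩

instance : Nonempty (FinPosContr H) :=
  ⟨⟨0, isFiniteRank_of_rank_le (k := 0) (by
    have : (0 : H →L[ℂ] H).toLinearMap.rank = 0 := LinearMap.rank_zero
    rw [this]; exact zero_le), le_rfl, zero_le_one⟩⟩

/-- A finite rank projection `Q` that almost fixes the range of `A₀` has a small perturbation of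
bounded rank which dominates `A₀`: for the projection `P` onto the range of `A₀`, take
`A = P + (1 - P) Q (1 - P)`, so that `P ≤ A ≤ 1` and `A - Q = P (1 - Q) + (1 - P) (1 - Q) P`. -/
theorem exists_finPosContr_ge (A₀ : FinPosContr H) : ∃ (m : ℕ) (e : Fin m → H),
    ∀ (Q : H →L[ℂ] H) (δ : ℝ), 0 ≤ δ → IsStarProjection Q → IsFiniteRank Q →
      (∀ i, ‖e i - Q (e i)‖ ≤ δ) →
      ∃ A : FinPosContr H, A₀ ≤ A ∧ (A.1 - Q).toLinearMap.rank ≤ (m + m : ℕ) ∧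
        ‖A.1 - Q‖ ≤ 2 * (m * δ) := by
  have hfin : FiniteDimensional ℂ A₀.1.range := A₀.2.1
  set K := A₀.1.range
  set P := K.starProjection with hPdef
  have hP : IsStarProjection P := isStarProjection_starProjection
  have hPP : P * P = P := hP.isIdempotentElem
  have hrP := rank_starProjection_le K
  have hn1 : ‖1 - P‖ ≤ 1 := IsStarProjection.norm_le _ hP.one_sub
  refine ⟨Module.finrank ℂ K, fun i => stdOrthonormalBasis ℂ K i, fun Q δ hδ hQ hQf h => ?_⟩
  have hX : ‖(1 - Q) * P‖ ≤ Module.finrank ℂ K * δ :=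
    norm_mul_starProjection_le K (1 - Q) hδ h
  have hXs : ‖P * (1 - Q)‖ ≤ Module.finrank ℂ K * δ := by
    rw [← norm_star, star_mul, hP.isSelfAdjoint.star_eq, hQ.one_sub.isSelfAdjoint.star_eq]
    exact hX
  have hdiff : P + (1 - P) * Q * (1 - P) - Q = P * (1 - Q) + (1 - P) * ((1 - Q) * P) := by
    have : (1 - P) * ((1 - Q) * P) = (P - P * P) - Q * P + P * Q * P := by noncomm_ring
    rw [this, hPP]; noncomm_ring
  have hrank : (P * (1 - Q) + (1 - P) * ((1 - Q) * P)).toLinearMap.rank ≤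
      (Module.finrank ℂ K + Module.finrank ℂ K : ℕ) :=
    rank_add_le (rank_mul_right_le hrP _) (rank_mul_left_le (rank_mul_left_le hrP _) _)
  have hPle : P ≤ P + (1 - P) * Q * (1 - P) :=
    le_add_of_nonneg_right (hP.one_sub.isSelfAdjoint.conjugate_nonneg hQ.nonneg)
  refine ⟨⟨P + (1 - P) * Q * (1 - P), ?_, hP.nonneg.trans hPle, ?_⟩, ?_, ?_, ?_⟩
  · obtain ⟨k, hk⟩ : ∃ k : ℕ, Q.toLinearMap.rank ≤ k := by
      have : FiniteDimensional ℂ Q.range := hQf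
      exact ⟨_, (Module.finrank_eq_rank ℂ Q.range).ge⟩
    exact isFiniteRank_of_rank_le
      (rank_add_le hrP (rank_mul_right_le (rank_mul_left_le hk _) _))
  · calc P + (1 - P) * Q * (1 - P) ≤ P + (1 - P) * 1 * (1 - P) := by
          gcongr
          exact hP.one_sub.isSelfAdjoint.conjugate_le_conjugate hQ.le_one
      _ = 1 := by rw [mul_one, hP.one_sub.isIdempotentElem.eq]; abel
  · exact (le_starProjection_of_range_le A₀.2.2.1 A₀.2.2.2 le_rfl).trans hPle
  · rw [hdiff]; exact hrank
  · rw [hdiff]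
    calc _ ≤ ‖P * (1 - Q)‖ + ‖(1 - P) * ((1 - Q) * P)‖ := norm_add_le _ _
      _ ≤ Module.finrank ℂ K * δ + 1 * (Module.finrank ℂ K * δ) := by
          refine add_le_add hXs ((norm_mul_le _ _).trans ?_)
          exact mul_le_mul hn1 hX (norm_nonneg _) zero_le_one
      _ = _ := by ring

/-- A criterion for `k_φ(τ) ≤ c`: there are finite rank projections `Q` that almost fix any given
vectors, and whose commutators with `τ j` have rank at most `L` and norm at most `s`, with `s` small
and `s · p_j L^{1/p_j} ≤ c`. -/
theorem quasicentralModulus_le_of_forall_exists_projection {n : ℕ} {p : Fin n → ℝ}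
    (hp : ∀ j, 1 < p j) (τ : Fin n → H →L[ℂ] H) {c : ℝ} (hc : 0 ≤ c)
    (h : ∀ (m : ℕ) (e : Fin m → H) (δ : ℝ), 0 < δ → ∃ Q : H →L[ℂ] H,
      IsStarProjection Q ∧ IsFiniteRank Q ∧ (∀ i, ‖e i - Q (e i)‖ ≤ δ) ∧
      ∀ j, ∃ (L : ℕ) (s : ℝ), ⁅τ j, Q⁆.toLinearMap.rank ≤ L ∧ ‖⁅τ j, Q⁆‖ ≤ s ∧ s ≤ δ ∧
        s * (p j * (L : ℝ) ^ (1 / p j)) ≤ c) :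
    quasicentralModulus (fun j => lorentzMinus (p j) (hp j)) τ ≤ ENNReal.ofReal c := by
  refine ENNReal.le_of_forall_pos_le_add fun ε hε _ => ?_
  refine Filter.liminf_le_of_frequently_le' (Filter.frequently_atTop.mpr fun A₀ => ?_)
  obtain ⟨m, e, hA⟩ := exists_finPosContr_ge A₀
  -- `δ` is chosen after `m`, so that the errors coming from the perturbation are at most `ε`
  set B : ℝ := 4 * m + 2 * (‖τ‖ * (2 * m)) * (4 * m) with hB
  have hB0 : 0 ≤ B := by positivity
  have hδ : 0 < (ε : ℝ) / (B + 1) := by positivity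
  obtain ⟨Q, hQ, hQf, hQe, hQτ⟩ := h m e _ hδ
  obtain ⟨A, hA₀, hrank, hnorm⟩ := hA Q _ hδ.le hQ hQf hQe
  refine ⟨A, hA₀, iSup_le fun j => ?_⟩
  obtain ⟨L, s, hL, hs, hsδ, hsc⟩ := hQτ j
  have hsplit : ⁅τ j, A.1⁆ = ⁅τ j, Q⁆ + ⁅τ j, A.1 - Q⁆ := by
    simp only [Ring.lie_def, mul_sub, sub_mul]; abel
  change opNorm (lorentzMinus (p j) (hp j)) ⁅τ j, A.1⁆ ≤ _
  rw [hsplit, ← ENNReal.ofReal_coe_nnreal, ← ENNReal.ofReal_add hc ε.coe_nonneg]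
  refine (opNorm_lorentzMinus_add_le (hp j) hL (rank_lie_le hrank (τ j))).trans
    (ENNReal.ofReal_le_ofReal ?_)
  have hp0 : 0 < p j := by linarith [hp j]
  have hτj : ‖τ j‖ ≤ ‖τ‖ := norm_le_pi_norm τ j
  have hR : ‖⁅τ j, A.1 - Q⁆‖ ≤ 2 * (‖τ‖ * (2 * (m * (ε / (B + 1))))) :=
    (norm_lie_le _ _).trans (by gcongr)
  calc ‖⁅τ j, Q⁆‖ * (p j * (L : ℝ) ^ (1 / p j) + (m + m + (m + m) : ℕ)) +
        ‖⁅τ j, A.1 - Q⁆‖ * (m + m + (m + m) : ℕ)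
      ≤ s * (p j * (L : ℝ) ^ (1 / p j) + (m + m + (m + m) : ℕ)) +
        2 * (‖τ‖ * (2 * (m * (ε / (B + 1))))) * (m + m + (m + m) : ℕ) := by gcongr
    _ = s * (p j * (L : ℝ) ^ (1 / p j)) + s * (4 * m) +
        2 * (‖τ‖ * (2 * (m * (ε / (B + 1))))) * (4 * m) := by push_cast; ring
    _ ≤ c + ε / (B + 1) * (4 * m) + 2 * (‖τ‖ * (2 * (m * (ε / (B + 1))))) * (4 * m) := by
        gcongr
    _ = c + ε * (B / (B + 1)) := by rw [hB]; ring
    _ ≤ c + ε := by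
        gcongr
        exact mul_le_of_le_one_right ε.2 ((div_le_one (by positivity)).mpr (by linarith))

end Projections

/-! ### The joint functional calculus -/

section JointFunctionalCalculus

open MeasureTheory Metric CompactlySupported

variable {H : Type u} [NormedAddCommGroup H] [InnerProductSpace ℂ H] [CompleteSpace H]
  {n : ℕ} {τ : Fin n → H →L[ℂ] H}

open WeakDual in
theorem norm_jointSpectrumMap_le (hτ : IsCommutingHermitian τ) :
    letI := commCStarAlgebra hτ
    ∀ χ : characterSpace ℂ (generatedAlgebra τ), ‖jointSpectrumMap hτ χ‖ ≤ ‖τ‖ := by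
  let _ := commCStarAlgebra hτ
  intro χ
  refine (pi_norm_le_iff_of_nonneg (norm_nonneg _)).mpr fun j => ?_
  have h1 : ‖χ ⟨τ j, mem_generatedAlgebra τ j⟩‖ ≤ ‖τ j‖ :=
    (AlgHom.norm_apply_le_self_mul_norm_one (CharacterSpace.toAlgHom χ) _).trans
      (mul_le_of_le_one_right (norm_nonneg _) ContinuousLinearMap.norm_id_le)
  exact ((Complex.abs_re_le_norm _).trans h1).trans (norm_le_pi_norm τ j)

/-- The values of `f` outside the ball of radius `‖τ‖` for the supremum norm do not matter, as this
ball contains the joint spectrum. -/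
theorem jointCfc_congr (hτ : IsCommutingHermitian τ) {f g : C(Fin n → ℝ, ℂ)}
    (h : Set.EqOn f g (closedBall 0 ‖τ‖)) : jointCfc hτ f = jointCfc hτ g := by
  let _ := commCStarAlgebra hτ
  have key : ContinuousMap.compStarAlgHom' ℂ ℂ (jointSpectrumMap hτ) f =
      ContinuousMap.compStarAlgHom' ℂ ℂ (jointSpectrumMap hτ) g := by
    ext χ
    exact h (by simpa using norm_jointSpectrumMap_le hτ χ)
  show (generatedAlgebra τ).subtype ((gelfandStarTransform (generatedAlgebra τ)).symm
    (ContinuousMap.compStarAlgHom' ℂ ℂ (jointSpectrumMap hτ) _)) =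
    (generatedAlgebra τ).subtype ((gelfandStarTransform (generatedAlgebra τ)).symm
    (ContinuousMap.compStarAlgHom' ℂ ℂ (jointSpectrumMap hτ) _))
  rw [key]

instance (hτ : IsCommutingHermitian τ) (ξ : H) : (scalarSpectralMeasure hτ ξ).Regular :=
  RealRMK.regular_rieszMeasure _

theorem scalarSpectralMeasure_compl_closedBall (hτ : IsCommutingHermitian τ) (ξ : H) :
    scalarSpectralMeasure hτ ξ (closedBall 0 ‖τ‖)ᶜ = 0 := by
  rw [isClosed_closedBall.isOpen_compl.measure_eq_iSup_isCompact]
  simp only [ENNReal.iSup_eq_zero]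
  intro K hK hKc
  obtain ⟨f, hf1, hf0, hfc, hf⟩ := exists_continuous_one_zero_of_isCompact hKc
    isClosed_closedBall (Set.disjoint_left.mpr fun x hx => hK hx)
  let F : C_c(Fin n → ℝ, ℝ) := ⟨f, hfc⟩
  have hint : ∫ x, F x ∂(scalarSpectralMeasure hτ ξ) = 0 := by
    rw [integral_scalarSpectralMeasure, jointCfc_congr hτ (g := 0), map_zero]
    · simp
    · intro x hx
      have : f x = 0 := hf0 hx
      simp [toComplex, F, this]
  have hi : Integrable F (scalarSpectralMeasure hτ ξ) :=
    F.continuous.integrable_of_hasCompactSupport hfc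
  have hae := (integral_eq_zero_iff_of_nonneg (fun x => (hf x).1) hi).mp hint
  refine measure_mono_null (fun x hx => ?_) hae
  have : f x = 1 := hf1 hx
  simp [this]

theorem ae_mem_closedBall (hτ : IsCommutingHermitian τ) (ξ : H) :
    ∀ᵐ x ∂(scalarSpectralMeasure hτ ξ), x ∈ closedBall (0 : Fin n → ℝ) ‖τ‖ :=
  scalarSpectralMeasure_compl_closedBall hτ ξ

instance (hτ : IsCommutingHermitian τ) (ξ : H) : IsFiniteMeasure (scalarSpectralMeasure hτ ξ) where
  measure_univ_lt_top := by
    rw [← Set.union_compl_self (closedBall (0 : Fin n → ℝ) ‖τ‖)]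
    refine (measure_union_le _ _).trans_lt ?_
    rw [scalarSpectralMeasure_compl_closedBall, add_zero]
    exact (isCompact_closedBall _ _).measure_lt_top

theorem inner_jointCfc_apply (hτ : IsCommutingHermitian τ) (f g : C(Fin n → ℝ, ℂ)) (u v : H) :
    inner ℂ (jointCfc hτ f u) (jointCfc hτ g v) = inner ℂ u (jointCfc hτ (star f * g) v) := by
  rw [map_mul, map_star, ContinuousLinearMap.star_eq_adjoint, mul_apply_eq_comp,
    ContinuousLinearMap.adjoint_inner_right]

theorem inner_jointCfc_apply_eq_zero (hτ : IsCommutingHermitian τ) {f g : C(Fin n → ℝ, ℂ)}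
    (h : ∀ x, f x = 0 ∨ g x = 0) (u v : H) :
    inner ℂ (jointCfc hτ f u) (jointCfc hτ g v) = 0 := by
  have : star f * g = 0 := by
    ext x
    rcases h x with h | h <;> simp [h]
  rw [inner_jointCfc_apply, this, map_zero]
  simp

theorem exists_compactlySupported_eqOn {f : (Fin n → ℝ) → ℝ} (hf : Continuous f) (r : ℝ) :
    ∃ F : C_c(Fin n → ℝ, ℝ), Set.EqOn F f (closedBall 0 r) := by
  obtain ⟨χ, hχ1, -, hχc, -⟩ := exists_continuous_one_zero_of_isCompact
    (isCompact_closedBall (0 : Fin n → ℝ) r) isClosed_empty (by simp)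
  refine ⟨⟨⟨fun x => χ x * f x, by fun_prop⟩, hχc.mul_right⟩, fun x hx => ?_⟩
  have : χ x = 1 := hχ1 hx
  simp [this]

theorem integrable_scalarSpectralMeasure (hτ : IsCommutingHermitian τ) (ξ : H)
    {f : (Fin n → ℝ) → ℝ} (hf : Continuous f) : Integrable f (scalarSpectralMeasure hτ ξ) := by
  obtain ⟨F, hF⟩ := exists_compactlySupported_eqOn hf ‖τ‖
  have hi : Integrable F (scalarSpectralMeasure hτ ξ) :=
    F.continuous.integrable_of_hasCompactSupport F.hasCompactSupport
  exact hi.congr ((ae_mem_closedBall hτ ξ).mono fun x hx => hF hx)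

theorem norm_jointCfc_apply_sq (hτ : IsCommutingHermitian τ) (f : C(Fin n → ℝ, ℂ)) (ξ : H) :
    ‖jointCfc hτ f ξ‖ ^ 2 = ∫ x, ‖f x‖ ^ 2 ∂(scalarSpectralMeasure hτ ξ) := by
  obtain ⟨F, hF⟩ := exists_compactlySupported_eqOn (f := fun x => ‖f x‖ ^ 2) (by fun_prop) ‖τ‖
  have h1 : jointCfc hτ (star f * f) = jointCfc hτ (toComplex F) := by
    refine jointCfc_congr hτ fun x hx => ?_
    have := hF hx
    simp [toComplex, this, Complex.conj_mul']
  rw [← integral_congr_ae ((ae_mem_closedBall hτ ξ).mono fun x hx => hF hx),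
    integral_scalarSpectralMeasure, ← h1, ← inner_jointCfc_apply]
  exact (inner_self_eq_norm_sq (𝕜 := ℂ) _).symm

theorem norm_jointCfc_apply_le (hτ : IsCommutingHermitian τ) {f g : C(Fin n → ℝ, ℂ)} {s : ℝ}
    (hs : 0 ≤ s) (h : ∀ x, ‖f x‖ ≤ s * ‖g x‖) (ξ : H) :
    ‖jointCfc hτ f ξ‖ ≤ s * ‖jointCfc hτ g ξ‖ := by
  refine le_of_sq_le_sq ?_ (by positivity)
  rw [mul_pow, norm_jointCfc_apply_sq, norm_jointCfc_apply_sq, ← integral_const_mul]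
  refine integral_mono (integrable_scalarSpectralMeasure hτ ξ (by fun_prop))
    (integrable_scalarSpectralMeasure hτ ξ (by fun_prop)) fun x => ?_
  simp only [← mul_pow]
  gcongr
  exact h x

end JointFunctionalCalculus

/-! ### Almost invariant subspaces from disjointly supported functions -/

section AlmostInvariant

open MeasureTheory Metric

/-- Urysohn functions of finitely many disjoint compact sets can be chosen with pairwise zero
products. -/
theorem exists_continuous_one_zero_of_pairwise_disjoint {X β : Type*} [TopologicalSpace X]
    [T2Space X] [LocallyCompactSpace X] [Fintype β] {K V : β → Set X} (hK : ∀ b, IsCompact (K b))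
    (hd : Pairwise fun a b => Disjoint (K a) (K b)) (hV : ∀ b, IsClosed (V b))
    (hKV : ∀ b, Disjoint (K b) (V b)) :
    ∃ f : β → C(X, ℝ), (∀ b, Set.EqOn (f b) 1 (K b)) ∧ (∀ b, Set.EqOn (f b) 0 (V b)) ∧
      (∀ b x, f b x ∈ Set.Icc (0 : ℝ) 1) ∧ ∀ a b, a ≠ b → ∀ x, f a x = 0 ∨ f b x = 0 := by
  classical
  have h : ∀ b, ∃ g : C(X, ℝ), Set.EqOn g 1 (K b) ∧ Set.EqOn g 0 (V b ∪ ⋃ a ∈ {a | a ≠ b}, K a) ∧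
      HasCompactSupport g ∧ ∀ x, g x ∈ Set.Icc (0 : ℝ) 1 := fun b => by
    refine exists_continuous_one_zero_of_isCompact (hK b)
      ((hV b).union ((Set.toFinite _).isClosed_biUnion fun a _ => (hK a).isClosed)) ?_
    refine Set.disjoint_union_right.mpr ⟨hKV b, ?_⟩
    exact Set.disjoint_iUnion₂_right.mpr fun a ha => hd (Ne.symm ha)
  choose g hg1 hg0 _ hg using h
  -- where `f a` and `f b` are both non-zero, `g a` and `g b` each exceed the other
  refine ⟨fun b => ⟨fun x => max 0 (g b x - ∑ a ∈ Finset.univ.erase b, g a x), by fun_prop⟩,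
    fun b x hx => ?_, fun b x hx => ?_, fun b x => ⟨le_max_left _ _, ?_⟩, fun a b hab x => ?_⟩
  · have h1 : g b x = 1 := hg1 b hx
    have h2 : ∑ a ∈ Finset.univ.erase b, g a x = 0 := Finset.sum_eq_zero fun a ha =>
      hg0 a (Or.inr (Set.mem_biUnion (Finset.ne_of_mem_erase ha).symm hx))
    simp only [ContinuousMap.coe_mk, h1, h2, sub_zero, Pi.one_apply]
    exact max_eq_right zero_le_one
  · have h1 : g b x = 0 := hg0 b (Or.inl hx)
    simp only [ContinuousMap.coe_mk, h1, zero_sub, Pi.zero_apply]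
    exact max_eq_left (neg_nonpos.mpr (Finset.sum_nonneg fun a _ => (hg a x).1))
  · refine max_le zero_le_one ?_
    have := Finset.sum_nonneg (s := Finset.univ.erase b) fun a _ => (hg a x).1
    linarith [(hg b x).2]
  · simp only [ContinuousMap.coe_mk]
    have h1 : g b x ≤ ∑ c ∈ Finset.univ.erase a, g c x := Finset.single_le_sum
      (f := fun c => g c x) (fun c _ => (hg c x).1) (by simp [hab.symm])
    have h2 : g a x ≤ ∑ c ∈ Finset.univ.erase b, g c x := Finset.single_le_sum
      (f := fun c => g c x) (fun c _ => (hg c x).1) (by simp [hab])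
    rcases le_total (g a x) (g b x) with h | h
    · left; exact max_eq_left (by linarith)
    · right; exact max_eq_left (by linarith)

variable {H : Type u} [NormedAddCommGroup H] [InnerProductSpace ℂ H]

theorem norm_sub_starProjection_le (K : Submodule ℂ H) [K.HasOrthogonalProjection] (x : H)
    {y : H} (hy : y ∈ K) : ‖x - K.starProjection x‖ ≤ ‖x - y‖ := by
  rw [Submodule.starProjection_minimal]
  exact ciInf_le ⟨0, by rintro _ ⟨z, rfl⟩; exact norm_nonneg _⟩ (⟨y, hy⟩ : K)

theorem norm_sum_sq_of_pairwise_inner_eq_zero {β : Type*} [Fintype β] (v : β → H)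
    (h : ∀ a b, a ≠ b → inner ℂ (v a) (v b) = 0) : ‖∑ b, v b‖ ^ 2 = ∑ b, ‖v b‖ ^ 2 := by
  rw [← @inner_self_eq_norm_sq ℂ, sum_inner, map_sum]
  refine Finset.sum_congr rfl fun a _ => ?_
  rw [inner_sum, Finset.sum_eq_single a (fun b _ hb => h a b hb.symm) (by simp),
    @inner_self_eq_norm_sq ℂ]

variable [CompleteSpace H]

/-- If `A` maps `K` into itself up to a relative error `s`, then `(1 - P) A P` has norm at most `s`,
and `[A, P]` is the difference of this operator and its adjoint. -/
theorem norm_lie_starProjection_le {A : H →L[ℂ] H} (hA : IsSelfAdjoint A) (K : Submodule ℂ H)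
    [K.HasOrthogonalProjection] {s : ℝ} (hs : 0 ≤ s)
    (h : ∀ x ∈ K, ∃ y ∈ K, ‖A x - y‖ ≤ s * ‖x‖) : ‖⁅A, K.starProjection⁆‖ ≤ 2 * s := by
  set P := K.starProjection
  have hP : IsStarProjection P := isStarProjection_starProjection
  have hX : ‖(1 - P) * A * P‖ ≤ s := by
    refine ContinuousLinearMap.opNorm_le_bound _ hs fun z => ?_
    obtain ⟨y, hy, hxy⟩ := h (P z) (Submodule.starProjection_apply_mem K z)
    have hPy : P y = y := Submodule.starProjection_eq_self_iff.mpr hy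
    have : ((1 - P) * A * P) z = (1 - P) (A (P z) - y) := by
      change A (P z) - P (A (P z)) = A (P z) - y - P (A (P z) - y)
      rw [map_sub, hPy]; abel
    rw [this]
    calc _ ≤ ‖1 - P‖ * ‖A (P z) - y‖ := (1 - P).le_opNorm _
      _ ≤ 1 * (s * ‖z‖) := by
          refine mul_le_mul (IsStarProjection.norm_le _ hP.one_sub) (hxy.trans ?_)
            (norm_nonneg _) zero_le_one
          gcongr
          exact K.norm_starProjection_apply_le z
      _ = _ := one_mul _
  have hsplit : ⁅A, P⁆ = (1 - P) * A * P - star ((1 - P) * A * P) := by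
    rw [star_mul, star_mul, hP.isSelfAdjoint.star_eq, hA.star_eq, hP.one_sub.isSelfAdjoint.star_eq,
      Ring.lie_def]
    noncomm_ring
  rw [hsplit]
  calc _ ≤ ‖(1 - P) * A * P‖ + ‖star ((1 - P) * A * P)‖ := norm_sub_le _ _
    _ ≤ s + s := by rw [norm_star]; exact add_le_add hX hX
    _ = _ := by ring

variable {n : ℕ} {τ : Fin n → H →L[ℂ] H}

/-- The vectors `f_b(τ) h_i` with `f_b` carried by a small box around `c_b` span a space that is
almost invariant under `τ`. The error does not depend on the number of boxes, because the
contributions of different boxes are orthogonal. -/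
theorem exists_submodule_of_disjoint_functions (hτ : IsCommutingHermitian τ) {β : Type*}
    [Fintype β] {m : ℕ} (h : Fin m → H) (f : β → C(Fin n → ℝ, ℂ)) (c : β → Fin n → ℝ)
    {s : Fin n → ℝ} (hs : ∀ j, 0 ≤ s j) (hd : ∀ a b, a ≠ b → ∀ x, f a x = 0 ∨ f b x = 0)
    (hf : ∀ b x, f b x ≠ 0 → ∀ j, |x j - c b j| ≤ s j) :
    ∃ S : Submodule ℂ H, FiniteDimensional ℂ S ∧ Module.finrank ℂ S ≤ Fintype.card β * m ∧
      (∀ b i, jointCfc hτ (f b) (h i) ∈ S) ∧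
      ∀ j, ∀ x ∈ S, ∃ y ∈ S, ‖τ j x - y‖ ≤ s j * ‖x‖ := by
  refine ⟨Submodule.span ℂ (Set.range fun bi : β × Fin m => jointCfc hτ (f bi.1) (h bi.2)),
    FiniteDimensional.span_of_finite ℂ (Set.finite_range _), ?_,
    fun b i => Submodule.subset_span ⟨(b, i), rfl⟩, fun j x hx => ?_⟩
  · exact (finrank_range_le_card _).trans (by simp)
  · obtain ⟨a, rfl⟩ := Submodule.mem_span_range_iff_exists_fun ℂ |>.mp hx
    set u : β → H := fun b => ∑ i, a (b, i) • h i with hu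
    have hx : ∑ bi, a bi • jointCfc hτ (f bi.1) (h bi.2) = ∑ b, jointCfc hτ (f b) (u b) := by
      rw [Fintype.sum_prod_type]
      refine Finset.sum_congr rfl fun b _ => ?_
      rw [hu, map_sum]
      exact Finset.sum_congr rfl fun i _ => (map_smul _ _ _).symm
    rw [hx]
    refine ⟨∑ b, (c b j : ℂ) • jointCfc hτ (f b) (u b), ?_, ?_⟩
    · refine Submodule.sum_mem _ fun b _ => Submodule.smul_mem _ _ ?_
      rw [hu, map_sum]
      refine Submodule.sum_mem _ fun i _ => ?_
      rw [map_smul]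
      exact Submodule.smul_mem _ _ (Submodule.subset_span ⟨(b, i), rfl⟩)
    · -- the error is the orthogonal sum of the vectors `((x j - c b j) f b)(τ) (u b)`
      let g : β → C(Fin n → ℝ, ℂ) := fun b => ⟨fun x => ((x j : ℂ) - c b j) * f b x, by fun_prop⟩
      have hg : ∀ b, jointCfc hτ (g b) (u b) =
          τ j (jointCfc hτ (f b) (u b)) - (c b j : ℂ) • jointCfc hτ (f b) (u b) := fun b => by
        have : g b = (⟨fun x => (x j : ℂ), by fun_prop⟩ : C(Fin n → ℝ, ℂ)) * f b -
            (c b j : ℂ) • f b := by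
          ext x; simp [g, sub_mul]
        rw [this, map_sub, map_mul, map_smul, jointCfc_coord]
        rfl
      rw [map_sum, ← Finset.sum_sub_distrib, Finset.sum_congr rfl fun b _ => (hg b).symm]
      refine le_of_sq_le_sq ?_ (mul_nonneg (hs j) (norm_nonneg _))
      rw [mul_pow, norm_sum_sq_of_pairwise_inner_eq_zero, norm_sum_sq_of_pairwise_inner_eq_zero,
        Finset.mul_sum]
      · refine Finset.sum_le_sum fun b _ => ?_
        rw [← mul_pow]
        gcongr
        refine norm_jointCfc_apply_le hτ (hs j) (fun x => ?_) _
        rw [ContinuousMap.coe_mk, norm_mul]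
        by_cases hfx : f b x = 0
        · simp [hfx]
        · gcongr
          rw [← Complex.ofReal_sub, Complex.norm_real]
          exact hf b x hfx j
      · exact fun a b hab => inner_jointCfc_apply_eq_zero hτ (hd a b hab) _ _
      · refine fun a b hab => inner_jointCfc_apply_eq_zero hτ (fun x => ?_) _ _
        rcases hd a b hab x with h | h <;> simp [g, h]

theorem scalarSpectralMeasure_real_univ (hτ : IsCommutingHermitian τ) (ξ : H) :
    (scalarSpectralMeasure hτ ξ).real Set.univ = ‖ξ‖ ^ 2 := by
  have := norm_jointCfc_apply_sq hτ 1 ξ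
  rw [map_one] at this
  simpa using this.symm

theorem norm_jointCfc_apply_sq_le (hτ : IsCommutingHermitian τ) (f : C(Fin n → ℝ, ℂ)) (ξ : H)
    {A : Set (Fin n → ℝ)} (hA : MeasurableSet A) {ω M : ℝ}
    (hω : ∀ x ∈ A, ‖f x‖ ≤ ω) (hM : ∀ x ∈ closedBall 0 ‖τ‖, ‖f x‖ ≤ M) :
    ‖jointCfc hτ f ξ‖ ^ 2 ≤ ω ^ 2 * ‖ξ‖ ^ 2 + M ^ 2 * (scalarSpectralMeasure hτ ξ).real Aᶜ := by
  rw [norm_jointCfc_apply_sq]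
  have hi : Integrable (Aᶜ.indicator fun _ => M ^ 2) (scalarSpectralMeasure hτ ξ) :=
    (integrable_const _).indicator hA.compl
  calc _ ≤ ∫ x, (ω ^ 2 + Aᶜ.indicator (fun _ => M ^ 2) x) ∂(scalarSpectralMeasure hτ ξ) := by
        refine integral_mono_ae (integrable_scalarSpectralMeasure hτ ξ (by fun_prop))
          ((integrable_const _).add hi) ((ae_mem_closedBall hτ ξ).mono fun x hx => ?_)
        by_cases hxA : x ∈ A
        · simp only [Set.mem_compl_iff, hxA, not_true_eq_false, not_false_eq_true,
            Set.indicator_of_notMem, add_zero]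
          have := hω x hxA
          gcongr
        · have := hM x hx
          have h2 : ‖f x‖ ^ 2 ≤ M ^ 2 := by gcongr
          simp only [Set.mem_compl_iff, hxA, not_false_eq_true, Set.indicator_of_mem]
          nlinarith [sq_nonneg ω]
    _ = _ := by
        rw [integral_add (integrable_const _) hi, integral_const,
          integral_indicator_const _ hA.compl,
          scalarSpectralMeasure_real_univ]
        simp [mul_comm]

end AlmostInvariant

/-! ### Boxes -/

section Boxes

open MeasureTheory Metric

/-- The index of the cell `∏ⱼ [bⱼ σⱼ, (bⱼ + 1) σⱼ)` containing `x`, in the partition of `ℝⁿ` into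
boxes with sides `σⱼ`. -/
noncomputable def cellIndex {n : ℕ} (σ : Fin n → ℝ) (x : Fin n → ℝ) : Fin n → ℤ :=
  fun j => ⌊x j / σ j⌋

section Cells

variable {n : ℕ} {σ : Fin n → ℝ}

theorem measurable_cellIndex : Measurable (cellIndex σ) :=
  measurable_pi_iff.mpr fun j => Int.measurable_floor.comp (by fun_prop)

theorem cellIndex_eq_iff (hσ : ∀ j, 0 < σ j) {x : Fin n → ℝ} {b : Fin n → ℤ} :
    cellIndex σ x = b ↔ ∀ j, x j ∈ Set.Ico (b j * σ j) (b j * σ j + σ j) := by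
  rw [funext_iff]
  refine forall_congr' fun j => ?_
  rw [cellIndex, Int.floor_eq_iff, le_div_iff₀ (hσ j), div_lt_iff₀ (hσ j), add_mul, one_mul,
    Set.mem_Ico]

theorem abs_sub_le_of_cellIndex_eq (hσ : ∀ j, 0 < σ j) {x y : Fin n → ℝ}
    (h : cellIndex σ x = cellIndex σ y) (j : Fin n) : |x j - y j| ≤ σ j := by
  have hx := (cellIndex_eq_iff hσ).mp h j
  have hy := (cellIndex_eq_iff hσ).mp (rfl : cellIndex σ y = _) j
  rw [abs_le]
  constructor <;> linarith [hx.1, hx.2, hy.1, hy.2]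

theorem volume_cell (hσ : ∀ j, 0 < σ j) (b : Fin n → ℤ) :
    volume (cellIndex σ ⁻¹' {b}) = ENNReal.ofReal (∏ j, σ j) := by
  have : cellIndex σ ⁻¹' {b} =
      Set.univ.pi fun j => Set.Ico ((b j : ℝ) * σ j) (b j * σ j + σ j) := by
    ext x
    simp only [Set.mem_preimage, Set.mem_singleton_iff, cellIndex_eq_iff hσ, Set.mem_univ_pi]
  rw [this, Real.volume_pi_Ico, ENNReal.ofReal_prod_of_nonneg fun j _ => (hσ j).le]
  simp

theorem cellIndex_image_subset (hσ : ∀ j, 0 < σ j) {K : Set (Fin n → ℝ)} {R : ℝ}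
    (hR : K ⊆ closedBall 0 R) :
    cellIndex σ '' K ⊆ (Fintype.piFinset fun j => Finset.Icc ⌊-R / σ j⌋ ⌊R / σ j⌋ :
      Finset (Fin n → ℤ)) := by
  rintro _ ⟨x, hx, rfl⟩
  simp only [Finset.mem_coe, Fintype.mem_piFinset, Finset.mem_Icc]
  intro j
  have h1 : ‖x‖ ≤ R := by simpa using hR hx
  have h2 := abs_le.mp ((norm_le_pi_norm x j).trans h1)
  have := (hσ j).le
  exact ⟨Int.floor_le_floor (by gcongr; exact h2.1), Int.floor_le_floor (by gcongr; exact h2.2)⟩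

theorem finite_cellIndex_image (hσ : ∀ j, 0 < σ j) {K : Set (Fin n → ℝ)}
    (hK : Bornology.IsBounded K) : (cellIndex σ '' K).Finite := by
  obtain ⟨R, hR⟩ := hK.subset_closedBall 0
  exact (Finset.finite_toSet _).subset (cellIndex_image_subset hσ hR)

theorem ncard_cellIndex_image_le (hσ : ∀ j, 0 < σ j) {K : Set (Fin n → ℝ)} {R : ℝ}
    (hR0 : 0 ≤ R) (hR : K ⊆ closedBall 0 R) :
    ((cellIndex σ '' K).ncard : ℝ) ≤ ∏ j, (2 * (R / σ j) + 2) := by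
  have h1 := Set.ncard_le_ncard (cellIndex_image_subset hσ hR) (Finset.finite_toSet _)
  rw [Set.ncard_coe_finset, Fintype.card_piFinset] at h1
  calc ((cellIndex σ '' K).ncard : ℝ)
      ≤ ((∏ j, (Finset.Icc ⌊-R / σ j⌋ ⌊R / σ j⌋).card : ℕ) : ℝ) := by exact_mod_cast h1
    _ ≤ _ := by
        push_cast
        refine Finset.prod_le_prod (fun _ _ => by positivity) fun j _ => ?_
        have h0 : 0 ≤ R / σ j := div_nonneg hR0 (hσ j).le
        rw [Int.card_Icc]
        have hle : ⌊-R / σ j⌋ ≤ ⌊R / σ j⌋ + 1 := by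
          have : ⌊-R / σ j⌋ ≤ ⌊R / σ j⌋ := Int.floor_le_floor (by rw [neg_div]; linarith)
          omega
        have hcast : (((⌊R / σ j⌋ + 1 - ⌊-R / σ j⌋).toNat : ℕ) : ℝ) =
            ⌊R / σ j⌋ + 1 - ⌊-R / σ j⌋ := by
          have := Int.toNat_of_nonneg (sub_nonneg.mpr hle)
          exact_mod_cast congrArg (Int.cast : ℤ → ℝ) this
        rw [hcast]
        have h3 := Int.floor_le (R / σ j)
        have h4 := Int.lt_floor_add_one (-R / σ j)
        rw [neg_div] at h4 ⊢
        linarith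

/-- The cells that meet `K` have total volume at most that of a thickening of `K`. -/
theorem ncard_cellIndex_image_mul_le (hσ : ∀ j, 0 < σ j) {K : Set (Fin n → ℝ)}
    (hK : Bornology.IsBounded K) {r : ℝ} (hr : ∀ j, σ j ≤ r) :
    ((cellIndex σ '' K).ncard : ℝ≥0∞) * ENNReal.ofReal (∏ j, σ j) ≤ volume (cthickening r K) := by
  have hfin := finite_cellIndex_image hσ hK
  rw [Set.ncard_eq_toFinset_card _ hfin]
  have hdisj : (hfin.toFinset : Set (Fin n → ℤ)).PairwiseDisjoint fun b => cellIndex σ ⁻¹' {b} :=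
    fun a _ b _ hab => Disjoint.preimage _ (Set.disjoint_singleton.mpr hab)
  calc _ = ∑ b ∈ hfin.toFinset, volume (cellIndex σ ⁻¹' {b}) := by
        simp [volume_cell hσ]
    _ = volume (⋃ b ∈ hfin.toFinset, cellIndex σ ⁻¹' {b}) :=
        (measure_biUnion_finset hdisj fun b _ =>
          measurable_cellIndex (measurableSet_singleton b)).symm
    _ ≤ _ := by
        refine measure_mono (Set.iUnion₂_subset fun b hb x hx => ?_)
        obtain ⟨y, hy, rfl⟩ := hfin.mem_toFinset.mp hb
        rcases isEmpty_or_nonempty (Fin n) with h0 | ⟨⟨j⟩⟩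
        · rw [Subsingleton.elim x y]
          exact self_subset_cthickening _ hy
        refine mem_cthickening_of_dist_le x y r K hy ?_
        refine (dist_pi_le_iff ((hσ j).le.trans (hr j))).mpr fun j => ?_
        exact (abs_sub_le_of_cellIndex_eq hσ hx j).trans (hr j)

end Cells

variable {H : Type u} [NormedAddCommGroup H] [InnerProductSpace ℂ H] [CompleteSpace H]
  {n : ℕ} {τ : Fin n → H →L[ℂ] H}

/-- Inner regularity, applied in every cell that meets `K`. -/
theorem exists_isCompact_subset_cells (ν : Measure (Fin n → ℝ)) [IsFiniteMeasure ν]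
    {σ : Fin n → ℝ} (hσ : ∀ j, 0 < σ j) {K : Set (Fin n → ℝ)} (hK : IsCompact K) {η : ℝ}
    (hη : 0 < η) :
    ∃ L : (cellIndex σ '' K : Set (Fin n → ℤ)) → Set (Fin n → ℝ),
      (∀ b, IsCompact (L b)) ∧ (∀ b, L b ⊆ K ∩ cellIndex σ ⁻¹' {b.1}) ∧
      ν.real (⋃ b, L b)ᶜ ≤ ν.real Kᶜ + η := by
  have hfin := finite_cellIndex_image hσ hK.isBounded
  have := hfin.fintype
  set β := (cellIndex σ '' K : Set (Fin n → ℤ))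
  have hε : ENNReal.ofReal (η / (Fintype.card β + 1)) ≠ 0 := by
    rw [Ne, ENNReal.ofReal_eq_zero, not_le]; positivity
  have hcell : ∀ b : β, MeasurableSet (K ∩ cellIndex σ ⁻¹' {b.1}) := fun b =>
    hK.measurableSet.inter (measurable_cellIndex (measurableSet_singleton _))
  choose L hL hLc hLν using fun b =>
    (hcell b).exists_isCompact_sdiff_lt (μ := ν) (measure_ne_top _ _) hε
  refine ⟨L, hLc, hL, ?_⟩
  have hsub : (⋃ b, L b)ᶜ ⊆ Kᶜ ∪ ⋃ b, ((K ∩ cellIndex σ ⁻¹' {b.1}) \ L b) := by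
    intro x hx
    by_cases hxK : x ∈ K
    · refine Or.inr (Set.mem_iUnion.mpr ⟨⟨cellIndex σ x, x, hxK, rfl⟩, ⟨hxK, rfl⟩, fun hxL => ?_⟩)
      exact hx (Set.mem_iUnion.mpr ⟨_, hxL⟩)
    · exact Or.inl hxK
  calc ν.real (⋃ b, L b)ᶜ ≤ ν.real Kᶜ + ν.real (⋃ b, ((K ∩ cellIndex σ ⁻¹' {b.1}) \ L b)) :=
        (measureReal_mono hsub).trans (measureReal_union_le _ _)
    _ ≤ ν.real Kᶜ + ∑ b : β, η / (Fintype.card β + 1) := by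
        gcongr
        refine (measureReal_iUnion_fintype_le _).trans (Finset.sum_le_sum fun b _ => ?_)
        exact ENNReal.toReal_le_of_le_ofReal (by positivity) (hLν b).le
    _ ≤ ν.real Kᶜ + η := by
        gcongr
        rw [Finset.sum_const, nsmul_eq_mul, Finset.card_univ, mul_div_left_comm]
        exact mul_le_of_le_one_right hη.le ((div_le_one (by positivity)).mpr (by linarith))

/-- The almost invariant subspace obtained from the cells that meet `K`, and how well it
approximates the vectors `G(τ) h_i`. The continuous functional calculus suffices: up to measure `η`,
the cells are replaced by disjoint compact sets, and the indicator functions of these by Urysohn functions. -/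
theorem exists_submodule_of_cells (hτ : IsCommutingHermitian τ) {m : ℕ} (h : Fin m → H)
    {σ : Fin n → ℝ} (hσ : ∀ j, 0 < σ j) {K : Set (Fin n → ℝ)} (hK : IsCompact K)
    (hKτ : K ⊆ closedBall 0 ‖τ‖) (ν : Measure (Fin n → ℝ)) [IsFiniteMeasure ν]
    (hν : ∀ i, scalarSpectralMeasure hτ (h i) ≤ ν) {η : ℝ} (hη : 0 < η) :
    ∃ S : Submodule ℂ H, ∃ _ : FiniteDimensional ℂ S,
      Module.finrank ℂ S ≤ (cellIndex σ '' K).ncard * m ∧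
      (∀ j, ‖⁅τ j, S.starProjection⁆‖ ≤ 4 * σ j) ∧
      ∀ i (G : C(Fin n → ℝ, ℂ)) (ω M : ℝ), (∀ x ∈ closedBall 0 ‖τ‖, ‖G x‖ ≤ M) →
        (∀ x ∈ K, ∀ y ∈ K, (∀ j, |x j - y j| ≤ σ j) → ‖G x - G y‖ ≤ ω) →
        ‖jointCfc hτ G (h i) - S.starProjection (jointCfc hτ G (h i))‖ ^ 2 ≤
          ω ^ 2 * ‖h i‖ ^ 2 + (2 * M) ^ 2 * (ν.real Kᶜ + η) := by
  have hfin := finite_cellIndex_image hσ hK.isBounded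
  have := hfin.fintype
  obtain ⟨L, hLc, hLK, hLν⟩ := exists_isCompact_subset_cells ν hσ hK hη
  let β := (cellIndex σ '' K : Set (Fin n → ℤ))
  have hc : ∀ b : β, ∃ x ∈ K, cellIndex σ x = b := fun b => b.2
  choose c hcK hcb using hc
  have hLσ : ∀ b, ∀ x ∈ L b, ∀ j, |x j - c b j| ≤ σ j := fun b x hx =>
    abs_sub_le_of_cellIndex_eq hσ ((hLK b hx).2.trans (hcb b).symm)
  obtain ⟨f, hf1, hf0, hf, hfd⟩ := exists_continuous_one_zero_of_pairwise_disjoint hLc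
    (V := fun b => {x | ∃ j, 2 * σ j ≤ |x j - c b j|})
    (fun a b hab => (Disjoint.preimage _ (Set.disjoint_singleton.mpr fun h =>
      hab (Subtype.ext h))).mono ((hLK a).trans Set.inter_subset_right)
        ((hLK b).trans Set.inter_subset_right))
    (fun b => by
      simp only [Set.ofPred_exists]
      exact isClosed_iUnion_of_finite fun j => isClosed_le (by fun_prop) (by fun_prop))
    (fun b => Set.disjoint_left.mpr fun x hx ⟨j, hj⟩ => by linarith [hLσ b x hx j, hσ j])
  let F : β → C(Fin n → ℝ, ℂ) := fun b => ⟨fun x => (f b x : ℂ), by fun_prop⟩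
  obtain ⟨S, hS, hrank, hmem, hcomm⟩ := exists_submodule_of_disjoint_functions hτ h F c
    (s := fun j => 2 * σ j) (fun j => by linarith [hσ j])
    (fun a b hab x => by simpa [F] using hfd a b hab x)
    (fun b x hx j => by
      by_contra hlt
      exact hx (by
        have : f b x = 0 := hf0 b ⟨j, (not_le.mp hlt).le⟩
        simp [F, this]))
  refine ⟨S, hS, ?_, fun j => ?_, fun i G ω M hM hω => ?_⟩
  · rwa [← Nat.card_coe_set_eq, Nat.card_eq_fintype_card]
  · refine (norm_lie_starProjection_le (hτ.isSelfAdjoint j) S ?_ (hcomm j)).trans (by linarith)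
    linarith [hσ j]
  -- compare with the vector obtained from the step function `∑ b, G (c b) F b`
  have hy : jointCfc hτ (∑ b, G (c b) • F b) (h i) ∈ S := by
    rw [map_sum, sum_apply]
    refine Submodule.sum_mem _ fun b _ => ?_
    rw [map_smul]
    exact Submodule.smul_mem _ _ (hmem b i)
  calc _ ≤ ‖jointCfc hτ (G - ∑ b, G (c b) • F b) (h i)‖ ^ 2 := by
        rw [map_sub, _root_.sub_apply]
        gcongr
        exact norm_sub_starProjection_le S _ hy
    _ ≤ ω ^ 2 * ‖h i‖ ^ 2 + (2 * M) ^ 2 * (scalarSpectralMeasure hτ (h i)).real (⋃ b, L b)ᶜ := by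
        refine norm_jointCfc_apply_sq_le hτ _ _
          (MeasurableSet.iUnion fun b => (hLc b).measurableSet) ?_ ?_
        · intro x hx
          obtain ⟨b, hb⟩ := Set.mem_iUnion.mp hx
          have h1 : f b x = 1 := hf1 b hb
          have h2 : (∑ b, G (c b) • F b) x = G (c b) := by
            rw [ContinuousMap.sum_apply, Finset.sum_eq_single b]
            · simp [F, h1]
            · intro a _ hab
              have : f a x = 0 := (hfd a b hab x).resolve_right (by simp [h1])
              simp [F, this]
            · simp
          rw [ContinuousMap.sub_apply, h2]
          exact hω x (hLK b hb).1 _ (hcK b) (hLσ b x hb)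
        · intro x hx
          have hM0 : 0 ≤ M := (norm_nonneg _).trans (hM x hx)
          have h2 : ‖(∑ b, G (c b) • F b) x‖ ≤ M := by
            rw [ContinuousMap.sum_apply]
            by_cases hex : ∃ b, f b x ≠ 0
            · obtain ⟨b, hb⟩ := hex
              rw [Finset.sum_eq_single b]
              · simp only [ContinuousMap.smul_apply, smul_eq_mul, norm_mul, F, ContinuousMap.coe_mk,
                  Complex.norm_real, Real.norm_eq_abs, abs_of_nonneg (hf b x).1]
                exact (mul_le_of_le_one_right (norm_nonneg _) (hf b x).2).trans
                  (hM _ (hKτ (hcK b)))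
              · intro a _ hab
                have : f a x = 0 := (hfd a b hab x).resolve_right hb
                simp [F, this]
              · simp
            · push Not at hex
              rw [Finset.sum_eq_zero fun b _ => by simp [F, hex b]]
              simpa using hM0
          rw [ContinuousMap.sub_apply]
          linarith [norm_sub_le (G x) ((∑ b, G (c b) • F b) x), hM x hx]
    _ ≤ ω ^ 2 * ‖h i‖ ^ 2 + (2 * M) ^ 2 * (ν.real Kᶜ + η) := by
        gcongr
        exact (ENNReal.toReal_mono (measure_ne_top _ _) (hν i _)).trans hLν

end Boxes

/-! ### Singular spectral measure and cyclic vectors -/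

section Estimates

open MeasureTheory Metric Filter Topology

variable {H : Type u} [NormedAddCommGroup H] [InnerProductSpace ℂ H] [CompleteSpace H]
  {n : ℕ} {τ : Fin n → H →L[ℂ] H}

/-- The projections given by boxes with sides `R t^{-1/p_j}`, which have volume `R^n / t`. When at
most `w t` of them are used, the powers of `t` cancel in the norms of the commutators. -/
theorem exists_projection_of_ncard_le (hτ : IsCommutingHermitian τ) {p : Fin n → ℝ}
    (hp : ∀ j, 1 < p j) {m : ℕ} (h : Fin m → H) {R t w : ℝ} (hR : 0 < R) (ht : 0 < t) (hw : 0 ≤ w)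
    {K : Set (Fin n → ℝ)} (hK : IsCompact K) (hKτ : K ⊆ closedBall 0 ‖τ‖)
    (hN : ((cellIndex (fun j => R * t ^ (-(1 / p j))) '' K).ncard : ℝ) ≤ w * t)
    (ν : Measure (Fin n → ℝ)) [IsFiniteMeasure ν]
    (hν : ∀ i, scalarSpectralMeasure hτ (h i) ≤ ν) {η : ℝ} (hη : 0 < η) :
    ∃ Q : H →L[ℂ] H, IsStarProjection Q ∧ IsFiniteRank Q ∧
      (∀ j, ∃ L : ℕ, ⁅τ j, Q⁆.toLinearMap.rank ≤ L ∧
        ‖⁅τ j, Q⁆‖ ≤ 4 * (R * t ^ (-(1 / p j))) ∧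
        4 * (R * t ^ (-(1 / p j))) * (p j * (L : ℝ) ^ (1 / p j)) ≤
          4 * R * p j * (2 * m * w) ^ (1 / p j)) ∧
      ∀ i (G : C(Fin n → ℝ, ℂ)) (ω M : ℝ), (∀ x ∈ closedBall 0 ‖τ‖, ‖G x‖ ≤ M) →
        (∀ x ∈ K, ∀ y ∈ K, (∀ j, |x j - y j| ≤ R * t ^ (-(1 / p j))) → ‖G x - G y‖ ≤ ω) →
        ‖jointCfc hτ G (h i) - Q (jointCfc hτ G (h i))‖ ^ 2 ≤
          ω ^ 2 * ‖h i‖ ^ 2 + (2 * M) ^ 2 * (ν.real Kᶜ + η) := by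
  obtain ⟨S, hS, hrank, hcomm, happrox⟩ := exists_submodule_of_cells hτ h
    (σ := fun j => R * t ^ (-(1 / p j))) (fun j => by positivity) hK hKτ ν hν hη
  refine ⟨S.starProjection, isStarProjection_starProjection,
    isFiniteRank_of_rank_le (rank_starProjection_le S), fun j =>
    ⟨_, rank_lie_le (rank_starProjection_le S) (τ j), hcomm j, ?_⟩, happrox⟩
  have hpj : 0 < p j := by linarith [hp j]
  have h1 : ((Module.finrank ℂ S + Module.finrank ℂ S : ℕ) : ℝ) ≤ 2 * m * w * t := by
    have : (Module.finrank ℂ S : ℝ) ≤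
        (cellIndex (fun j => R * t ^ (-(1 / p j))) '' K).ncard * m := by exact_mod_cast hrank
    have h2 := this.trans (mul_le_mul_of_nonneg_right hN (Nat.cast_nonneg m))
    push_cast
    linarith
  calc _ ≤ 4 * (R * t ^ (-(1 / p j))) * (p j * (2 * m * w * t) ^ (1 / p j)) := by gcongr
    _ = 4 * R * p j * (2 * m * w) ^ (1 / p j) * (t ^ (-(1 / p j)) * t ^ (1 / p j)) := by
        rw [Real.mul_rpow (by positivity) ht.le]; ring
    _ = _ := by rw [← Real.rpow_add ht, neg_add_cancel, Real.rpow_zero, mul_one]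

theorem prod_rpow_neg_one_div {p : Fin n → ℝ} (hsum : ∑ j, 1 / p j = 1) {t : ℝ} (ht : 0 < t) :
    ∏ j, t ^ (-(1 / p j)) = t⁻¹ := by
  rw [← Real.rpow_sum_of_pos ht, Finset.sum_neg_distrib, hsum, Real.rpow_neg_one]

theorem tendsto_mul_rpow_neg_one_div {q : ℝ} (hq : 1 < q) (R : ℝ) :
    Tendsto (fun t : ℝ => R * t ^ (-(1 / q))) atTop (𝓝 0) := by
  simpa using (tendsto_rpow_neg_atTop (y := 1 / q) (by positivity)).const_mul R

/-- A null compact set meets only a small proportion of the small boxes, so the bound of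
`exists_projection_of_ncard_le` holds with small `w`, whatever the number of vectors to be
approximated. -/
theorem quasicentralModulus_eq_zero_of_hasSingularSpectralMeasure {p : Fin n → ℝ}
    (hp : ∀ j, 1 < p j) (hsum : ∑ j, 1 / p j = 1) (hτ : IsCommutingHermitian τ)
    (hsing : HasSingularSpectralMeasure hτ) :
    quasicentralModulus (fun j => lorentzMinus (p j) (hp j)) τ = 0 := by
  obtain ⟨Z, hZ, hZ0, hZτ⟩ := hsing
  refine le_antisymm (ENNReal.le_of_forall_pos_le_add fun c hc _ => ?_) zero_le
  rw [zero_add, ← ENNReal.ofReal_coe_nnreal]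
  refine quasicentralModulus_le_of_forall_exists_projection hp τ c.coe_nonneg fun m e δ hδ => ?_
  let ν : Measure (Fin n → ℝ) := ∑ i, scalarSpectralMeasure hτ (e i)
  have hν : ∀ i, scalarSpectralMeasure hτ (e i) ≤ ν := fun i =>
    Finset.single_le_sum (f := fun i => scalarSpectralMeasure hτ (e i))
      (fun _ _ => Measure.zero_le _) (Finset.mem_univ i)
  have hνZ : ν (Z ∩ closedBall 0 ‖τ‖)ᶜ = 0 := by
    rw [Measure.finsetSum_apply]
    refine Finset.sum_eq_zero fun i _ => ?_
    rw [Set.compl_inter]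
    exact measure_union_null (hZτ _) (scalarSpectralMeasure_compl_closedBall hτ _)
  have hη : 0 < δ ^ 2 / 8 := by positivity
  obtain ⟨K, hKZ, hK, hKν⟩ := (hZ.inter measurableSet_closedBall).exists_isCompact_sdiff_lt
    (μ := ν) (measure_ne_top _ _) (ENNReal.ofReal_pos.mpr hη).ne'
  have hKν' : ν.real Kᶜ ≤ δ ^ 2 / 8 := by
    refine ENNReal.toReal_le_of_le_ofReal hη.le ?_
    calc ν Kᶜ ≤ ν ((Z ∩ closedBall 0 ‖τ‖)ᶜ ∪ (Z ∩ closedBall 0 ‖τ‖) \ K) := by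
          refine measure_mono fun x hx => ?_
          by_cases hxZ : x ∈ Z ∩ closedBall 0 ‖τ‖
          exacts [Or.inr ⟨hxZ, hx⟩, Or.inl hxZ]
      _ ≤ _ := (measure_union_le _ _).trans (by rw [hνZ, zero_add]; exact hKν.le)
  -- `w` bounds the proportion of cells that meet `K`; it is small since `K` is a null set
  obtain ⟨w, hw0, hw⟩ : ∃ w : ℝ, 0 < w ∧ ∀ j, 4 * 1 * p j * (2 * m * w) ^ (1 / p j) ≤ c := by
    have hev : ∀ j, ∀ᶠ w : ℝ in 𝓝[>] 0, 4 * 1 * p j * (2 * m * w) ^ (1 / p j) ≤ c := fun j => by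
      have hpj : 0 < p j := by linarith [hp j]
      have hcont : Continuous fun w : ℝ => 4 * 1 * p j * (2 * m * w) ^ (1 / p j) :=
        continuous_const.mul ((Real.continuous_rpow_const (by positivity)).comp (by fun_prop))
      have := (hcont.tendsto 0).mono_left (nhdsWithin_le_nhds (s := Set.Ioi 0))
      rw [mul_zero, Real.zero_rpow (by positivity), mul_zero] at this
      exact this.eventually_le_const hc
    obtain ⟨w, h1, h2⟩ := ((eventually_all.mpr hev).and self_mem_nhdsWithin).exists
    exact ⟨w, h2, h1⟩
  have hK0 : volume K = 0 := measure_mono_null (hKZ.trans Set.inter_subset_left) hZ0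
  obtain ⟨r, hr0, hr⟩ : ∃ r : ℝ, 0 < r ∧ volume (cthickening r K) ≤ ENNReal.ofReal w := by
    have := tendsto_measure_cthickening_of_isCompact (μ := volume) hK
    rw [hK0] at this
    have h1 := (this.mono_left (nhdsWithin_le_nhds (s := Set.Ioi 0))).eventually_le_const
      (ENNReal.ofReal_pos.mpr hw0)
    obtain ⟨r, h1, h2⟩ := (h1.and self_mem_nhdsWithin).exists
    exact ⟨r, h2, h1⟩
  obtain ⟨t, ht0, ht⟩ : ∃ t : ℝ, 0 < t ∧ ∀ j, 1 * t ^ (-(1 / p j)) ≤ min r (δ / 4) := by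
    have hev : ∀ j, ∀ᶠ t : ℝ in atTop, 1 * t ^ (-(1 / p j)) ≤ min r (δ / 4) := fun j =>
      (tendsto_mul_rpow_neg_one_div (hp j) 1).eventually_le_const (by positivity)
    obtain ⟨t, h1, h2⟩ := ((eventually_all.mpr hev).and (eventually_gt_atTop 0)).exists
    exact ⟨t, h2, h1⟩
  have hN : ((cellIndex (fun j => 1 * t ^ (-(1 / p j))) '' K).ncard : ℝ) ≤ w * t := by
    have h1 := (ncard_cellIndex_image_mul_le (σ := fun j => 1 * t ^ (-(1 / p j)))
      (fun j => by positivity) hK.isBounded fun j => (ht j).trans (min_le_left _ _)).trans hr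
    simp only [one_mul] at h1 ⊢
    rw [prod_rpow_neg_one_div hsum ht0, ← ENNReal.ofReal_natCast, ← ENNReal.ofReal_mul (by simp),
      ENNReal.ofReal_le_ofReal_iff hw0.le, ← div_eq_mul_inv, div_le_iff₀ ht0] at h1
    exact h1
  obtain ⟨Q, hQ, hQf, hQτ, hQe⟩ := exists_projection_of_ncard_le hτ hp e one_pos ht0 hw0.le hK
    (hKZ.trans Set.inter_subset_right) hN ν hν hη
  refine ⟨Q, hQ, hQf, fun i => ?_, fun j => ?_⟩
  · have := hQe i 1 0 1 (by simp) (by simp)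
    rw [map_one] at this
    refine le_of_sq_le_sq (this.trans ?_) hδ.le
    nlinarith
  · obtain ⟨L, h1, h2, h3⟩ := hQτ j
    exact ⟨L, _, h1, h2, by linarith [(ht j).trans (min_le_right _ _)], h3.trans (hw j)⟩

theorem exists_jointCfc_eq_of_mem_adjoin (hτ : IsCommutingHermitian τ) {a : H →L[ℂ] H}
    (ha : a ∈ Algebra.adjoin ℂ (Set.range τ)) : ∃ g, jointCfc hτ g = a := by
  have : Algebra.adjoin ℂ (Set.range τ) ≤ ((jointCfc hτ : C(Fin n → ℝ, ℂ) →ₐ[ℂ] _)).range := by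
    refine Algebra.adjoin_le ?_
    rintro _ ⟨j, rfl⟩
    exact ⟨_, jointCfc_coord hτ j⟩
  exact this ha

/-- Here `∑ 1 / p_j = 1` makes the number of boxes proportional to `t`. -/
theorem ncard_cellIndex_closedBall_le {p : Fin n → ℝ} (hp : ∀ j, 1 < p j)
    (hsum : ∑ j, 1 / p j = 1) {R r t : ℝ} (hr : 0 ≤ r) (hrR : r ≤ R) (hR : 0 < R) (ht : 1 ≤ t) :
    ((cellIndex (fun j => R * t ^ (-(1 / p j))) '' closedBall (0 : Fin n → ℝ) r).ncard : ℝ) ≤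
      4 ^ n * t := by
  have ht0 : 0 < t := by linarith
  have hσ : ∀ j, 0 < R * t ^ (-(1 / p j)) := fun j => by positivity
  refine (ncard_cellIndex_image_le hσ hr le_rfl).trans ?_
  calc ∏ j, (2 * (r / (R * t ^ (-(1 / p j)))) + 2) ≤ ∏ j, 4 * t ^ (1 / p j) := by
        refine Finset.prod_le_prod (fun j _ => by have := hσ j; positivity) fun j _ => ?_
        have h1 : r / (R * t ^ (-(1 / p j))) ≤ t ^ (1 / p j) := by
          rw [div_le_iff₀ (hσ j), mul_left_comm, ← Real.rpow_add ht0, add_neg_cancel,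
            Real.rpow_zero, mul_one]
          exact hrR
        have h2 : 1 ≤ t ^ (1 / p j) :=
          Real.one_le_rpow ht (by have := hp j; positivity)
        linarith
    _ = _ := by
        rw [Finset.prod_mul_distrib, ← Real.rpow_sum_of_pos ht0, hsum]
        simp

theorem exists_pos_forall_norm_sub_le {m : ℕ} (g : Fin m → C(Fin n → ℝ, ℂ)) (r : ℝ) {ω : ℝ}
    (hω : 0 < ω) : ∃ ρ > 0, ∀ i, ∀ x ∈ closedBall (0 : Fin n → ℝ) r, ∀ y ∈ closedBall 0 r,
      (∀ j, |x j - y j| ≤ ρ) → ‖g i x - g i y‖ ≤ ω := by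
  have hu : ∀ i, ∀ᶠ ρ : ℝ in 𝓝[>] 0, ∀ x ∈ closedBall (0 : Fin n → ℝ) r, ∀ y ∈ closedBall 0 r,
      (∀ j, |x j - y j| ≤ ρ) → ‖g i x - g i y‖ ≤ ω := fun i => by
    obtain ⟨ρ, hρ, h⟩ := Metric.uniformContinuousOn_iff.mp
      ((isCompact_closedBall (0 : Fin n → ℝ) r).uniformContinuousOn_of_continuous
        (g i).continuous.continuousOn) ω hω
    filter_upwards [Ioo_mem_nhdsGT hρ] with ρ' hρ' x hx y hy hxy
    rw [← dist_eq_norm]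
    exact (h x hx y hy (((dist_pi_le_iff hρ'.1.le).mpr hxy).trans_lt hρ'.2)).le
  obtain ⟨ρ, h1, h2⟩ := ((eventually_all.mpr hu).and self_mem_nhdsWithin).exists
  exact ⟨ρ, h2, h1⟩

/-- With a cyclic vector `ξ`, all boxes in the ball of radius `‖τ‖` are used, but each of them
contributes only one dimension. -/
theorem quasicentralModulus_le_of_isCyclicVector {p : Fin n → ℝ}
    (hp : ∀ j, 1 < p j) (hsum : ∑ j, 1 / p j = 1) (hτ : IsCommutingHermitian τ) {ξ : H}
    (hξ : IsCyclicVector τ ξ) {R : ℝ} (hR0 : 0 < R) (hR : ‖τ‖ ≤ R) :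
    quasicentralModulus (fun j => lorentzMinus (p j) (hp j)) τ ≤
      ENNReal.ofReal (8 * 4 ^ n * (∑ j, p j) * R) := by
  have hp0 : ∀ j, 0 < p j := fun j => by linarith [hp j]
  have hsum0 : 0 ≤ ∑ j, p j := Finset.sum_nonneg fun j _ => (hp0 j).le
  refine quasicentralModulus_le_of_forall_exists_projection hp τ (by positivity)
    fun m e δ hδ => ?_
  have hg : ∀ i, ∃ g, ‖e i - jointCfc hτ g ξ‖ ≤ δ / 2 := fun i => by
    obtain ⟨_, hlt, a, ha, rfl⟩ := Metric.dense_iff.mp hξ (e i) (δ / 2) (by positivity)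
    obtain ⟨g, rfl⟩ := exists_jointCfc_eq_of_mem_adjoin hτ ha
    exact ⟨g, by rw [← dist_eq_norm, dist_comm]; exact (mem_ball.mp hlt).le⟩
  choose g hg using hg
  obtain ⟨M, hM⟩ : ∃ M : ℝ, ∀ i, ∀ x ∈ closedBall (0 : Fin n → ℝ) ‖τ‖, ‖g i x‖ ≤ M := by
    choose M hM using fun i =>
      (isCompact_closedBall (0 : Fin n → ℝ) ‖τ‖).exists_bound_of_continuousOn
        (g i).continuous.continuousOn
    obtain ⟨B, hB⟩ := (Set.finite_range M).bddAbove
    exact ⟨B, fun i x hx => (hM i x hx).trans (hB ⟨i, rfl⟩)⟩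
  set ω := δ / (4 * (‖ξ‖ + 1)) with hω
  have hω0 : 0 < ω := by positivity
  have hωξ : ω ^ 2 * ‖ξ‖ ^ 2 ≤ (δ / 4) ^ 2 := by
    rw [← mul_pow]
    gcongr
    rw [hω, div_mul_eq_mul_div, div_le_div_iff₀ (by positivity) (by positivity)]
    nlinarith [norm_nonneg ξ]
  set η := δ ^ 2 / (16 * ((2 * M) ^ 2 + 1)) with hη
  have hη0 : 0 < η := by positivity
  have hMη : (2 * M) ^ 2 * η ≤ (δ / 4) ^ 2 := by
    rw [hη, mul_div_assoc', div_le_iff₀ (by positivity)]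
    nlinarith [sq_nonneg δ]
  obtain ⟨ρ, hρ0, hρ⟩ := exists_pos_forall_norm_sub_le g ‖τ‖ hω0
  obtain ⟨t, ht1, ht⟩ : ∃ t : ℝ, 1 ≤ t ∧ ∀ j, R * t ^ (-(1 / p j)) ≤ min ρ (δ / 4) := by
    have hev : ∀ j, ∀ᶠ t : ℝ in atTop, R * t ^ (-(1 / p j)) ≤ min ρ (δ / 4) := fun j =>
      (tendsto_mul_rpow_neg_one_div (hp j) R).eventually_le_const (by positivity)
    obtain ⟨t, h1, h2⟩ := ((eventually_all.mpr hev).and (eventually_ge_atTop 1)).exists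
    exact ⟨t, h2, h1⟩
  obtain ⟨Q, hQ, hQf, hQτ, hQe⟩ := exists_projection_of_ncard_le hτ hp (fun _ : Fin 1 => ξ) hR0
    (by linarith) (by positivity) (isCompact_closedBall _ _) le_rfl
    (ncard_cellIndex_closedBall_le hp hsum (norm_nonneg τ) hR hR0 ht1)
    (scalarSpectralMeasure hτ ξ) (fun _ => le_rfl) hη0
  refine ⟨Q, hQ, hQf, fun i => ?_, fun j => ?_⟩
  · have h1 := hQe 0 (g i) ω M (hM i) fun x hx y hy hxy =>
      hρ i x hx y hy fun j => (hxy j).trans ((ht j).trans (min_le_left _ _))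
    have h0 : (scalarSpectralMeasure hτ ξ).real (closedBall 0 ‖τ‖)ᶜ = 0 := by
      rw [Measure.real, scalarSpectralMeasure_compl_closedBall, ENNReal.toReal_zero]
    rw [h0, zero_add] at h1
    have h2 : ‖jointCfc hτ (g i) ξ - Q (jointCfc hτ (g i) ξ)‖ ≤ δ / 2 :=
      le_of_sq_le_sq (by nlinarith) (by positivity)
    -- `e i - Q (e i) = (1 - Q) (e i - g) + (g - Q g)` for the approximant `g = g(τ) ξ`
    have h3 : e i - Q (e i) = (1 - Q) (e i - jointCfc hτ (g i) ξ) +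
        (jointCfc hτ (g i) ξ - Q (jointCfc hτ (g i) ξ)) := by
      change _ = e i - jointCfc hτ (g i) ξ - Q (e i - jointCfc hτ (g i) ξ) + _
      rw [map_sub]; abel
    have h4 : ‖(1 - Q) (e i - jointCfc hτ (g i) ξ)‖ ≤ δ / 2 := by
      refine ((1 - Q).le_opNorm _).trans ?_
      exact (mul_le_of_le_one_left (norm_nonneg _) (IsStarProjection.norm_le _ hQ.one_sub)).trans
        (hg i)
    rw [h3]
    linarith [norm_add_le ((1 - Q) (e i - jointCfc hτ (g i) ξ))
      (jointCfc hτ (g i) ξ - Q (jointCfc hτ (g i) ξ))]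
  · obtain ⟨L, h1, h2, h3⟩ := hQτ j
    refine ⟨L, _, h1, h2, by linarith [(ht j).trans (min_le_right _ _)], h3.trans ?_⟩
    have h4 : (2 * (1 : ℕ) * 4 ^ n : ℝ) ^ (1 / p j) ≤ 2 * 4 ^ n := by
      have h5 : (1 : ℝ) ≤ 2 * 4 ^ n := by
        have : (1 : ℝ) ≤ 4 ^ n := one_le_pow₀ (by norm_num)
        linarith
      rw [Nat.cast_one, mul_one]
      exact Real.rpow_le_self_of_one_le h5 ((div_le_one (hp0 j)).mpr (hp j).le)
    have h6 : p j ≤ ∑ j, p j := Finset.single_le_sum (fun i _ => (hp0 i).le) (Finset.mem_univ j)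
    have := (hp0 j).le
    calc _ ≤ 4 * R * (∑ j, p j) * (2 * 4 ^ n) := by gcongr
      _ = _ := by ring

end Estimates

end HybridModulus

theorem mainTheorem5 {n : ℕ} (p : Fin n → ℝ) (hp : ∀ j, 1 < p j) (hsum : ∑ j, 1 / p j = 1) :
    (∀ (H : Type u) [NormedAddCommGroup H] [InnerProductSpace ℂ H] [CompleteSpace H]
        [TopologicalSpace.SeparableSpace H] (_ : ¬ FiniteDimensional ℂ H)
        (τ : Fin n → H →L[ℂ] H) (hτ : HybridModulus.IsCommutingHermitian τ),
        HybridModulus.HasSingularSpectralMeasure hτ →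
          HybridModulus.quasicentralModulus
            (fun j => HybridModulus.lorentzMinus (p j) (hp j)) τ = 0) ∧
    ∃ C : ℝ≥0,
      ∀ (H : Type u) [NormedAddCommGroup H] [InnerProductSpace ℂ H] [CompleteSpace H]
        [TopologicalSpace.SeparableSpace H] (_ : ¬ FiniteDimensional ℂ H)
        (τ : Fin n → H →L[ℂ] H) (_ : HybridModulus.IsCommutingHermitian τ),
        (∃ ξ : H, HybridModulus.IsCyclicVector τ ξ) →
          HybridModulus.quasicentralModulus
            (fun j => HybridModulus.lorentzMinus (p j) (hp j)) τ ≤ C * ‖τ‖ₑ := by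
  refine ⟨fun H _ _ _ _ _ τ hτ =>
    HybridModulus.quasicentralModulus_eq_zero_of_hasSingularSpectralMeasure hp hsum hτ,
    (8 * 4 ^ n * ∑ j, p j).toNNReal, fun H _ _ _ _ _ τ hτ ⟨ξ, hξ⟩ => ?_⟩
  have hC : 0 ≤ 8 * 4 ^ n * ∑ j, p j :=
    mul_nonneg (by positivity) (Finset.sum_nonneg fun j _ => by linarith [hp j])
  -- a radius `R > ‖τ‖` makes the boxes non-degenerate also when `τ = 0`; then `R → ‖τ‖`
  have hlim : Filter.Tendsto (fun R : ℝ => ENNReal.ofReal (8 * 4 ^ n * (∑ j, p j) * R))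
      (nhdsWithin ‖τ‖ (Set.Ioi ‖τ‖)) (nhds (ENNReal.ofReal (8 * 4 ^ n * (∑ j, p j) * ‖τ‖))) :=
    ((ENNReal.continuous_ofReal.comp (by fun_prop)).tendsto _).mono_left nhdsWithin_le_nhds
  have hlast : ((8 * 4 ^ n * ∑ j, p j).toNNReal : ℝ≥0∞) * ‖τ‖ₑ =
      ENNReal.ofReal (8 * 4 ^ n * (∑ j, p j) * ‖τ‖) := by
    rw [ENNReal.ofReal_mul hC, ofReal_norm]
    rfl
  rw [hlast]
  refine ge_of_tendsto hlim (Filter.eventually_of_mem self_mem_nhdsWithin fun R hR => ?_)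
  exact HybridModulus.quasicentralModulus_le_of_isCyclicVector hp hsum hτ hξ
    ((norm_nonneg τ).trans_lt hR) (le_of_lt hR)
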